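/- Let $G$ be a discrete group. Let $A(G)$ be its Fourier algebra, the predual of the group von Neumann algebra $VN(G)\subseteq B(\ell^2(G))$ with its predual operator space structure, regarded as the algebra of functions $x\mapsto\varphi(\lambda(x))$ on $G$ for $\varphi\in VN(G)_*$. Let $A_{cb}(G)$ be the closure of $A(G)$ in the space $CB(A(G))$ of completely bounded operators on $A(G)$, where $u\in A(G)$ acts by pointwise multiplication; its elements are again functions on $G$. Let $\ell^1(G)$ carry its operator space structure as the predual of $\ell^\infty(G)$, and let $\widehat{\otimes}$ be the operator space projective tensor product. Then $A_{cb}(G)$ is a completely contractive Banach algebra, $\ell^1(G)$ is a completely bounded left $A_{cb}(G)$-module under pointwise multiplication, and: (i) $\ell^1(G)$ is operator projective in $A_{cb}(G)$-$\mathbf{mod}$. That is, let $E,F$ be completely bounded left $A_{cb}(G)$-modules and let $T:E\to F$ be a surjective completely bounded module map which is admissible (the kernel of $T$ is completely complemented, and its range is closed and completely complemented). Then for every completely bounded module map $S:\ell^1(G)\to F$ there is a completely bounded module map $R:\ell^1(G)\to E$ with $T\circ R=S$. (ii) For every $s\in G$ the function $\delta_s$ belongs to $A_{cb}(G)$, and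 there is a completely contractive left $A_{cb}(G)$-module map $\rho:\ell^1(G)\to A_{cb}(G)\,\widehat{\otimes}\,\ell^1(G)$ with $\rho(\delta_s)=\delta_s\otimes\delta_s$ for all $s\in G$ which is a right inverse of the multiplication map $A_{cb}(G)\,\widehat{\otimes}\,\ell^1(G)\to\ell^1(G)$, $f\otimes g\mapsto fg$. Here $A_{cb}(G)\,\widehat{\otimes}\,\ell^1(G)$ is a completely bounded left $A_{cb}(G)$-module with $a\cdot(b\otimes g)=(ab)\otimes g$. -/

import Mathlib

open scoped Matrix.Norms.L2Operator
open Matrix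

noncomputable section

/-! ### Operator spaces -/

/-- The product `a X b` of a matrix `X` over a complex vector space with scalar matrices. -/
def scalarMulMul {ι κ V : Type*} [Fintype ι] [AddCommGroup V] [Module ℂ V]
    (a : Matrix κ ι ℂ) (X : Matrix ι ι V) (b : Matrix ι κ ℂ) : Matrix κ κ V :=
  Matrix.of fun k l => ∑ i, ∑ j, (a k i * b j l) • X i j

/-- An operator space structure on a normed space `V`: norms on all the matrix spaces `M_ι(V)`,
where `ι` is a finite index type (`M_n(V)` is the case `ι = Fin n`), which give back the norm of
`V` on `1 × 1` matrices and satisfy Ruan's axioms. Scalar matrices carry the operator norm.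
Homogeneity, definiteness and the equivalence with the entrywise norm follow; in particular
all the matrix spaces are complete if `V` is. -/
class OperatorSpace (V : Type*) [NormedAddCommGroup V] [NormedSpace ℂ V] where
  mnorm : ∀ {ι : Type} [Fintype ι], Matrix ι ι V → ℝ
  mnorm_add_le : ∀ {ι : Type} [Fintype ι] (X Y : Matrix ι ι V),
    mnorm (X + Y) ≤ mnorm X + mnorm Y
  mnorm_one_by_one : ∀ v : V, mnorm (Matrix.of fun _ _ : Unit => v) = ‖v‖
  mnorm_fromBlocks : ∀ {ι κ : Type} [Fintype ι] [Fintype κ] (X : Matrix ι ι V) (Y : Matrix κ κ V),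
    mnorm (Matrix.fromBlocks X 0 0 Y) = max (mnorm X) (mnorm Y)
  mnorm_scalarMulMul_le : ∀ {ι κ : Type} [Fintype ι] [Fintype κ] [DecidableEq ι] [DecidableEq κ]
    (a : Matrix κ ι ℂ) (X : Matrix ι ι V) (b : Matrix ι κ ℂ),
    mnorm (scalarMulMul a X b) ≤ ‖a‖ * mnorm X * ‖b‖

namespace OperatorSpace

lemma l2_sq {ι κ : Type*} [Fintype ι] [Fintype κ] [DecidableEq ι] (a : Matrix κ ι ℂ) (x : ι → ℂ) :
    ∑ k, ‖∑ i, a k i * x i‖ ^ 2 ≤ ‖a‖ ^ 2 * ∑ i, ‖x i‖ ^ 2 := by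
  have h := Matrix.l2_opNorm_mulVec a (WithLp.toLp 2 x)
  have h2 := pow_le_pow_left₀ (norm_nonneg _) h 2
  rw [mul_pow, EuclideanSpace.norm_sq_eq, EuclideanSpace.norm_sq_eq] at h2
  simpa [Matrix.mulVec, dotProduct] using h2

lemma l2_le {ι κ : Type*} [Fintype ι] [Fintype κ] [DecidableEq ι] (a : Matrix κ ι ℂ) {C : ℝ}
    (hC : 0 ≤ C) (h : ∀ x : ι → ℂ, ∑ k, ‖∑ i, a k i * x i‖ ^ 2 ≤ C ^ 2 * ∑ i, ‖x i‖ ^ 2) :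
    ‖a‖ ≤ C := by
  rw [Matrix.l2_opNorm_def]
  refine ContinuousLinearMap.opNorm_le_bound _ hC fun x => ?_
  refine le_of_sq_le_sq ?_ (by positivity)
  rw [mul_pow, EuclideanSpace.norm_sq_eq, EuclideanSpace.norm_sq_eq]
  simpa [Matrix.toLpLin_apply, Matrix.mulVec, dotProduct] using h x

/-- The `0`-`1` matrix of an injection has norm at most one. -/
lemma l2_inj {ι κ : Type*} [Fintype ι] [Fintype κ] [DecidableEq ι] (f : κ → ι)
    (hf : Function.Injective f) :
    ‖(Matrix.of fun k i => if f k = i then 1 else 0 : Matrix κ ι ℂ)‖ ≤ 1 := by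
  refine l2_le _ zero_le_one fun x => ?_
  simp only [Matrix.of_apply, ite_mul, one_mul, zero_mul, Finset.sum_ite_eq, Finset.mem_univ,
    if_true, one_pow]
  rw [← Finset.sum_image (f := fun i => ‖x i‖ ^ 2) (s := Finset.univ) (g := f) hf.injOn]
  exact Finset.sum_le_sum_of_subset_of_nonneg (Finset.subset_univ _) fun _ _ _ => by positivity

lemma l2_inj' {ι κ : Type*} [Fintype ι] [Fintype κ] [DecidableEq ι] [DecidableEq κ] (f : κ → ι)
    (hf : Function.Injective f) :
    ‖(Matrix.of fun i k => if f k = i then 1 else 0 : Matrix ι κ ℂ)‖ ≤ 1 := by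
  have := l2_inj f hf
  rw [← Matrix.l2_opNorm_conjTranspose] at this
  convert this using 2
  ext i k
  simp [Matrix.conjTranspose_apply, apply_ite]

/-- Amplification `a ⊗ 1` of a scalar matrix. -/
def ampl {ι κ : Type*} (ν : Type*) [DecidableEq ν] (a : Matrix κ ι ℂ) :
    Matrix (κ × ν) (ι × ν) ℂ :=
  Matrix.of fun p q => if p.2 = q.2 then a p.1 q.1 else 0

lemma l2_ampl {ι κ ν : Type*} [Fintype ι] [Fintype κ] [Fintype ν] [DecidableEq ι] [DecidableEq ν]
    (a : Matrix κ ι ℂ) : ‖ampl ν a‖ ≤ ‖a‖ := by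
  refine l2_le _ (norm_nonneg _) fun x => ?_
  simp only [ampl, Matrix.of_apply, ite_mul, zero_mul, Fintype.sum_prod_type,
    Finset.sum_ite_eq, Finset.mem_univ, if_true]
  rw [Finset.sum_comm, Finset.sum_comm (s := (Finset.univ : Finset ι)), Finset.mul_sum]
  exact Finset.sum_le_sum fun p _ => l2_sq a fun i => x (i, p)

section basic

variable {V : Type*} [NormedAddCommGroup V] [NormedSpace ℂ V] [OperatorSpace V]
  {ι κ : Type} [Fintype ι] [Fintype κ]

lemma mnorm_zero : mnorm (0 : Matrix ι ι V) = 0 := by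
  classical
  apply le_antisymm
  · have := mnorm_scalarMulMul_le (0 : Matrix ι ι ℂ) (0 : Matrix ι ι V) (0 : Matrix ι ι ℂ)
    have h : scalarMulMul (0 : Matrix ι ι ℂ) (0 : Matrix ι ι V) (0 : Matrix ι ι ℂ) = 0 := by
      ext; simp [scalarMulMul]
    simpa [h] using this
  · have := mnorm_add_le (0 : Matrix ι ι V) 0
    rw [add_zero] at this
    linarith

lemma mnorm_nonneg (X : Matrix ι ι V) : 0 ≤ mnorm X := by
  classical
  have h1 := mnorm_scalarMulMul_le (-1 : Matrix ι ι ℂ) X 1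
  have e1 : scalarMulMul (-1 : Matrix ι ι ℂ) X 1 = -X := by
    ext k l
    simp [scalarMulMul, Matrix.one_apply, ite_smul]
  have h3 := mnorm_add_le X (-X)
  have h4 : ‖(1 : Matrix ι ι ℂ)‖ ≤ 1 := l2_le _ zero_le_one fun x => by
    simp [Matrix.one_apply]
  rw [e1, norm_neg] at h1
  rw [add_neg_cancel, mnorm_zero] at h3
  by_contra hc
  push Not at hc
  nlinarith [norm_nonneg (1 : Matrix ι ι ℂ),
    mul_nonneg (norm_nonneg (1 : Matrix ι ι ℂ)) (norm_nonneg (1 : Matrix ι ι ℂ))]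

lemma mnorm_scalarMulMul_le' [DecidableEq ι] [DecidableEq κ] (a : Matrix κ ι ℂ) (X : Matrix ι ι V)
    (b : Matrix ι κ ℂ) {s t : ℝ} (ha : ‖a‖ ≤ s) (hb : ‖b‖ ≤ t) :
    mnorm (scalarMulMul a X b) ≤ s * mnorm X * t := by
  refine (mnorm_scalarMulMul_le a X b).trans ?_
  have := mnorm_nonneg X
  have := (norm_nonneg a).trans ha
  gcongr

lemma mnorm_smul_le (c : ℂ) (X : Matrix ι ι V) : mnorm (c • X) ≤ ‖c‖ * mnorm X := by
  classical
  have h := mnorm_scalarMulMul_le' (Matrix.of fun k i => if k = i then c else 0 : Matrix ι ι ℂ) X 1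
    (s := ‖c‖) (t := 1) (l2_le _ (norm_nonneg _) fun x => by
      simp [mul_pow, Finset.mul_sum]) (l2_le _ zero_le_one fun x => by simp [Matrix.one_apply])
  have e : scalarMulMul (Matrix.of fun k i => if k = i then c else 0 : Matrix ι ι ℂ) X 1
      = c • X := by
    ext k l
    simp [scalarMulMul, Matrix.one_apply, ite_smul]
  rw [e] at h
  simpa using h

lemma mnorm_submatrix_le (f g : κ → ι) (hf : Function.Injective f) (hg : Function.Injective g)
    (X : Matrix ι ι V) : mnorm (X.submatrix f g) ≤ mnorm X := by
  classical
  have h := mnorm_scalarMulMul_le' (Matrix.of fun k i => if f k = i then 1 else 0 : Matrix κ ι ℂ) X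
    (Matrix.of fun i k => if g k = i then 1 else 0 : Matrix ι κ ℂ) (l2_inj f hf) (l2_inj' g hg)
  have e : scalarMulMul (Matrix.of fun k i => if f k = i then 1 else 0 : Matrix κ ι ℂ) X
    (Matrix.of fun i k => if g k = i then 1 else 0 : Matrix ι κ ℂ) = X.submatrix f g := by
    ext k l
    simp [scalarMulMul, ite_smul, ← ite_and]
    rw [Finset.sum_eq_single (f k), Finset.sum_eq_single (g l)] <;> simp_all [eq_comm]
  rw [e] at h
  simpa using h

lemma mnorm_reindex (e : κ ≃ ι) (X : Matrix ι ι V) : mnorm (X.submatrix e e) = mnorm X := by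
  refine le_antisymm (mnorm_submatrix_le _ _ e.injective e.injective _) ?_
  have := mnorm_submatrix_le e.symm e.symm e.symm.injective e.symm.injective (X.submatrix e e)
  simpa using this

lemma norm_entry_le (X : Matrix ι ι V) (i j : ι) : ‖X i j‖ ≤ mnorm X := by
  rw [← mnorm_one_by_one]
  exact mnorm_submatrix_le (fun _ : Unit => i) (fun _ => j) (fun _ _ _ => rfl) (fun _ _ _ => rfl) X

lemma mnorm_sum_le {τ : Type*} (s : Finset τ) (X : τ → Matrix ι ι V) :
    mnorm (∑ t ∈ s, X t) ≤ ∑ t ∈ s, mnorm (X t) :=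
  Finset.le_sum_of_subadditive _ mnorm_zero.le mnorm_add_le _ _

/-- The norm of a block matrix is at most the sum of the norms of its blocks. -/
lemma mnorm_le_sum_blocks (Z : Matrix (ι × κ) (ι × κ) V) :
    mnorm Z ≤ ∑ i, ∑ j, mnorm (Matrix.of fun k l => Z (i, k) (j, l)) := by
  classical
  have inj : ∀ i : ι, Function.Injective fun k : κ => (i, k) := fun i k l h => (Prod.ext_iff.1 h).2
  have e : Z = ∑ i, ∑ j, scalarMulMul
      (Matrix.of fun p k => if (i, k) = p then 1 else 0 : Matrix (ι × κ) κ ℂ)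
      (Matrix.of fun k l => Z (i, k) (j, l))
      (Matrix.of fun k p => if (j, k) = p then 1 else 0 : Matrix κ (ι × κ) ℂ) := by
    ext ⟨i, k⟩ ⟨j, l⟩
    simp only [Matrix.sum_apply, scalarMulMul, Matrix.of_apply, Prod.mk.injEq]
    rw [Finset.sum_eq_single i, Finset.sum_eq_single j, Finset.sum_eq_single k,
      Finset.sum_eq_single l] <;> simp +contextual
  conv_lhs => rw [e]
  refine (mnorm_sum_le _ _).trans (Finset.sum_le_sum fun i _ => ?_)
  refine (mnorm_sum_le _ _).trans (Finset.sum_le_sum fun j _ => ?_)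
  simpa using mnorm_scalarMulMul_le' _ _ _ (l2_inj' _ (inj i)) (l2_inj _ (inj j))

lemma mnorm_le_sum (X : Matrix ι ι V) : mnorm X ≤ ∑ i, ∑ j, ‖X i j‖ := by
  have h := mnorm_le_sum_blocks (κ := Unit) (X.submatrix Prod.fst Prod.fst)
  have e := mnorm_reindex (Equiv.prodPUnit.{0, 0} ι) X
  rw [← e]
  refine h.trans (le_of_eq ?_)
  simp only [← mnorm_one_by_one]
  rfl

end basic

section tests

variable {Y W : Type*} [NormedAddCommGroup Y] [NormedSpace ℂ Y] [NormedAddCommGroup W]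
  [NormedSpace ℂ W] [OperatorSpace W] {T : Type*} (κ : T → Type) [∀ t, Fintype (κ t)]
  (θ : ∀ t, Y →ₗ[ℂ] Matrix (κ t) (κ t) W)

/-- The matrix `[θ_t(x_ij)]`, a matrix over `W` indexed by pairs. -/
def testMatrix (t : T) {ι : Type} (X : Matrix ι ι Y) : Matrix (ι × κ t) (ι × κ t) W :=
  Matrix.of fun p q => θ t (X p.1 q.1) p.2 q.2

lemma testMatrix_bdd (hb : ∀ y, BddAbove (Set.range fun t => mnorm (θ t y))) {ι : Type} [Fintype ι]
    (X : Matrix ι ι Y) : BddAbove (Set.range fun t => mnorm (testMatrix κ θ t X)) := by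
  choose C hC using hb
  refine ⟨∑ i, ∑ j, C (X i j), ?_⟩
  rintro _ ⟨t, rfl⟩
  refine (mnorm_le_sum_blocks _).trans (Finset.sum_le_sum fun i _ => Finset.sum_le_sum fun j _ => ?_)
  exact hC (X i j) ⟨t, rfl⟩

/-- The operator space structure determined by a family of matrix valued maps `θ_t` which is
bounded at every point: `‖[x_ij]‖` is the supremum over `t` of `‖[θ_t(x_ij)]‖`. -/
@[reducible] def ofTests [Nonempty T] (hb : ∀ y, BddAbove (Set.range fun t => mnorm (θ t y)))
    (hn : ∀ y, ‖y‖ = ⨆ t, mnorm (θ t y)) : OperatorSpace Y where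
  mnorm X := ⨆ t, mnorm (testMatrix κ θ t X)
  mnorm_add_le X X' := by
    refine ciSup_le fun t => ?_
    have e : testMatrix κ θ t (X + X') = testMatrix κ θ t X + testMatrix κ θ t X' := by
      ext; simp [testMatrix]
    rw [e]
    exact (mnorm_add_le _ _).trans (add_le_add (le_ciSup (testMatrix_bdd κ θ hb X) t)
      (le_ciSup (testMatrix_bdd κ θ hb X') t))
  mnorm_one_by_one v := by
    rw [hn]
    congr 1; ext t
    exact mnorm_reindex (Equiv.punitProd.{0, 0} (κ t)) (θ t v)
  mnorm_fromBlocks {ι ν} _ _ X X' := by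
    have key : ∀ t, mnorm (testMatrix κ θ t (Matrix.fromBlocks X 0 0 X')) =
        max (mnorm (testMatrix κ θ t X)) (mnorm (testMatrix κ θ t X')) := fun t => by
      rw [← mnorm_fromBlocks, ← mnorm_reindex (Equiv.sumProdDistrib ι ν (κ t))]
      congr 1
      ext ⟨i | i, k⟩ ⟨j | j, l⟩ <;> simp [testMatrix]
    apply le_antisymm
    · refine ciSup_le fun t => ?_
      rw [key]
      exact max_le_max (le_ciSup (testMatrix_bdd κ θ hb X) t)
        (le_ciSup (testMatrix_bdd κ θ hb X') t)
    · have hB := testMatrix_bdd κ θ hb (Matrix.fromBlocks X 0 0 X')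
      refine max_le (ciSup_le fun t => ?_) (ciSup_le fun t => ?_)
      · exact ((le_max_left _ _).trans (key t).ge).trans (le_ciSup hB t)
      · exact ((le_max_right _ _).trans (key t).ge).trans (le_ciSup hB t)
  mnorm_scalarMulMul_le {ι ν} _ _ _ _ a X b := by
    classical
    refine ciSup_le fun t => ?_
    have e : testMatrix κ θ t (scalarMulMul a X b) =
        scalarMulMul (ampl (κ t) a) (testMatrix κ θ t X) (ampl (κ t) b) := by
      ext ⟨i, k⟩ ⟨j, l⟩
      simp [testMatrix, scalarMulMul, ampl, Fintype.sum_prod_type, Matrix.sum_apply]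
    rw [e]
    refine (mnorm_scalarMulMul_le' _ _ _ (l2_ampl a) (l2_ampl b)).trans ?_
    gcongr
    exact le_ciSup (testMatrix_bdd κ θ hb X) t

end tests

/-- The operator space structure of a subspace, given by an isometry into an operator space. -/
@[reducible] def ofIsometry {V W : Type*} [NormedAddCommGroup V] [NormedSpace ℂ V]
    [NormedAddCommGroup W] [NormedSpace ℂ W] [OperatorSpace W] (J : V →ₗᵢ[ℂ] W) :
    OperatorSpace V where
  mnorm X := mnorm (X.map J)
  mnorm_add_le X Y := by
    rw [Matrix.map_add _ (map_add J)]
    exact mnorm_add_le _ _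
  mnorm_one_by_one v := (mnorm_one_by_one (J v)).trans (J.norm_map v)
  mnorm_fromBlocks X Y := by
    rw [← mnorm_fromBlocks]
    congr 1
    ext (i | i) (j | j) <;> simp
  mnorm_scalarMulMul_le a X b := by
    have e : (scalarMulMul a X b).map J = scalarMulMul a (X.map J) b := by
      ext; simp [scalarMulMul]
    rw [e]
    exact mnorm_scalarMulMul_le _ _ _

/-- A subspace of an operator space inherits the matrix norms. -/
instance subspace {V : Type*} [NormedAddCommGroup V] [NormedSpace ℂ V] [OperatorSpace V]
    (S : Submodule ℂ V) : OperatorSpace S := ofIsometry S.subtypeₗᵢ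

end OperatorSpace

namespace OperatorSpace

section hilbert

variable {H : Type*} [NormedAddCommGroup H] [InnerProductSpace ℂ H]
  {ι κ : Type} [Fintype ι] [Fintype κ]

/-- The operator on the Hilbert space direct sum `H^ι` given by a matrix of operators on `H`. -/
def matrixOperator (T : Matrix ι ι (H →L[ℂ] H)) :
    PiLp 2 (fun _ : ι => H) →L[ℂ] PiLp 2 (fun _ : ι => H) :=
  ((PiLp.continuousLinearEquiv 2 ℂ (fun _ : ι => H)).symm : (ι → H) →L[ℂ] PiLp 2 (fun _ : ι => H)) ∘L
    (ContinuousLinearMap.pi fun i => ∑ j, T i j ∘L ContinuousLinearMap.proj j) ∘L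
    (PiLp.continuousLinearEquiv 2 ℂ (fun _ : ι => H) : PiLp 2 (fun _ : ι => H) →L[ℂ] (ι → H))

lemma matrixOperator_apply (T : Matrix ι ι (H →L[ℂ] H)) (x : PiLp 2 (fun _ : ι => H)) (i : ι) :
    matrixOperator T x i = ∑ j, T i j (x j) := by
  simp [matrixOperator]

lemma matrixOperator_sq (T : Matrix ι ι (H →L[ℂ] H)) (x : ι → H) :
    ∑ i, ‖∑ j, T i j (x j)‖ ^ 2 ≤ ‖matrixOperator T‖ ^ 2 * ∑ i, ‖x i‖ ^ 2 := by
  have h := pow_le_pow_left₀ (norm_nonneg _) ((matrixOperator T).le_opNorm (WithLp.toLp 2 x)) 2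
  rw [mul_pow, PiLp.norm_sq_eq_of_L2, PiLp.norm_sq_eq_of_L2] at h
  simpa [matrixOperator_apply] using h

lemma matrixOperator_le (T : Matrix ι ι (H →L[ℂ] H)) {C : ℝ} (hC : 0 ≤ C)
    (h : ∀ x : ι → H, ∑ i, ‖∑ j, T i j (x j)‖ ^ 2 ≤ C ^ 2 * ∑ i, ‖x i‖ ^ 2) :
    ‖matrixOperator T‖ ≤ C := by
  refine ContinuousLinearMap.opNorm_le_bound _ hC fun x => ?_
  refine le_of_sq_le_sq ?_ (by positivity)
  rw [mul_pow, PiLp.norm_sq_eq_of_L2, PiLp.norm_sq_eq_of_L2]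
  simpa [matrixOperator_apply] using h x

/-- Scalar matrices act on tuples of vectors with their operator norm. -/
lemma l2_sq_vec [DecidableEq ι] (a : Matrix κ ι ℂ) (x : ι → H) :
    ∑ k, ‖∑ i, a k i • x i‖ ^ 2 ≤ ‖a‖ ^ 2 * ∑ i, ‖x i‖ ^ 2 := by
  let S := Submodule.span ℂ (Set.range x)
  have : FiniteDimensional ℂ S := FiniteDimensional.span_of_finite ℂ (Set.finite_range x)
  let y : ι → S := fun i => ⟨x i, Submodule.subset_span ⟨i, rfl⟩⟩
  let B := stdOrthonormalBasis ℂ S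
  have hn : ∀ v : S, ‖v‖ ^ 2 = ∑ p, ‖B.repr v p‖ ^ 2 := fun v => by
    rw [← B.repr.norm_map, EuclideanSpace.norm_sq_eq]
  have h1 : ∀ k, ‖∑ i, a k i • x i‖ ^ 2 = ∑ p, ‖∑ i, a k i * B.repr (y i) p‖ ^ 2 := fun k => by
    have : ∑ i, a k i • x i = ((∑ i, a k i • y i : S) : H) := by simp [y]
    rw [this]
    refine (hn (∑ i, a k i • y i)).trans ?_
    simp
  have h2 : ∀ i, ‖x i‖ ^ 2 = ∑ p, ‖B.repr (y i) p‖ ^ 2 := fun i => hn (y i)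
  simp only [h1, h2]
  rw [Finset.sum_comm, Finset.sum_comm (s := (Finset.univ : Finset ι)), Finset.mul_sum]
  exact Finset.sum_le_sum fun p _ => l2_sq a fun i => B.repr (y i) p

/-- The bounded operators on a Hilbert space: `M_n(B(H)) = B(H^n)`. -/
instance boundedOperators : OperatorSpace (H →L[ℂ] H) where
  mnorm T := ‖matrixOperator T‖
  mnorm_add_le X Y := by
    have e : matrixOperator (X + Y) = matrixOperator X + matrixOperator Y := by
      ext x i
      simp [matrixOperator_apply, Finset.sum_add_distrib]
    rw [e]
    exact norm_add_le (matrixOperator X) (matrixOperator Y)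
  mnorm_one_by_one v := by
    apply le_antisymm
    · refine matrixOperator_le _ (norm_nonneg _) fun x => ?_
      have := pow_le_pow_left₀ (norm_nonneg _) (v.le_opNorm (x ())) 2
      simpa [mul_pow] using this
    · refine v.opNorm_le_bound (ContinuousLinearMap.opNorm_nonneg _) fun x => le_of_sq_le_sq ?_ (by positivity)
      simpa [mul_pow] using matrixOperator_sq (Matrix.of fun _ _ : Unit => v) fun _ => x
  mnorm_fromBlocks X Y := by
    apply le_antisymm
    · refine matrixOperator_le _ (by positivity) fun x => ?_
      simp only [Fintype.sum_sum_type, Matrix.fromBlocks_apply₁₁, Matrix.fromBlocks_apply₁₂,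
        Matrix.fromBlocks_apply₂₁, Matrix.fromBlocks_apply₂₂, Matrix.zero_apply,
        _root_.zero_apply, Finset.sum_const_zero, add_zero, zero_add, mul_add]
      refine add_le_add ((matrixOperator_sq X _).trans ?_) ((matrixOperator_sq Y _).trans ?_)
      · gcongr; exact le_max_left _ _
      · gcongr; exact le_max_right _ _
    · refine max_le (matrixOperator_le _ (ContinuousLinearMap.opNorm_nonneg _) fun x => ?_)
        (matrixOperator_le _ (ContinuousLinearMap.opNorm_nonneg _) fun x => ?_)
      · simpa using matrixOperator_sq (Matrix.fromBlocks X 0 0 Y) (Sum.elim x 0)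
      · simpa using matrixOperator_sq (Matrix.fromBlocks X 0 0 Y) (Sum.elim 0 x)
  mnorm_scalarMulMul_le {ι κ} _ _ _ _ a X b := by
    refine matrixOperator_le _ (by positivity) fun x => ?_
    have e : ∀ k, ∑ l, scalarMulMul a X b k l (x l) =
        ∑ i, a k i • ∑ j, X i j (∑ l, b j l • x l) := fun k => by
      simp only [scalarMulMul, Matrix.of_apply, _root_.sum_apply,
        _root_.smul_apply, map_sum, map_smul, Finset.smul_sum, smul_smul]
      rw [Finset.sum_comm]
      refine Finset.sum_congr rfl fun i _ => ?_
      rw [Finset.sum_comm]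
    simp only [e]
    refine (l2_sq_vec a _).trans ?_
    calc _ ≤ ‖a‖ ^ 2 * (‖matrixOperator X‖ ^ 2 * (‖b‖ ^ 2 * ∑ l, ‖x l‖ ^ 2)) := by
          gcongr
          refine (matrixOperator_sq X _).trans ?_
          gcongr
          exact l2_sq_vec b x
      _ = _ := by ring

end hilbert

open Classical in
/-- The operator norm of a complex square matrix. -/
def l2Norm {ι : Type*} [Fintype ι] (X : Matrix ι ι ℂ) : ℝ := ‖X‖

lemma l2Norm_eq {ι : Type*} [Fintype ι] [DecidableEq ι] (X : Matrix ι ι ℂ) : l2Norm X = ‖X‖ := by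
  unfold l2Norm
  congr!

/-- The complex numbers: `M_n(ℂ)` carries the operator norm. -/
instance complex : OperatorSpace ℂ where
  mnorm X := l2Norm X
  mnorm_add_le X Y := by
    classical
    simp only [l2Norm_eq]
    exact norm_add_le X Y
  mnorm_one_by_one v := by
    rw [l2Norm_eq]
    apply le_antisymm
    · exact l2_le _ (norm_nonneg _) fun x => by simp [mul_pow]
    · have h := l2_sq (Matrix.of fun _ _ : Unit => v) fun _ => 1
      refine le_of_sq_le_sq ?_ (norm_nonneg _)
      simpa using h
  mnorm_fromBlocks X Y := by
    classical
    simp only [l2Norm_eq]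
    apply le_antisymm
    · refine l2_le _ (by positivity) fun x => ?_
      simp only [Fintype.sum_sum_type, Matrix.fromBlocks_apply₁₁, Matrix.fromBlocks_apply₁₂,
        Matrix.fromBlocks_apply₂₁, Matrix.fromBlocks_apply₂₂, Matrix.zero_apply, zero_mul,
        Finset.sum_const_zero, add_zero, zero_add, mul_add]
      refine add_le_add ((l2_sq X _).trans ?_) ((l2_sq Y _).trans ?_)
      · gcongr; exact le_max_left _ _
      · gcongr; exact le_max_right _ _
    · refine max_le (l2_le _ (norm_nonneg _) fun x => ?_) (l2_le _ (norm_nonneg _) fun x => ?_)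
      · simpa using l2_sq (Matrix.fromBlocks X 0 0 Y) (Sum.elim x 0)
      · simpa using l2_sq (Matrix.fromBlocks X 0 0 Y) (Sum.elim 0 x)
  mnorm_scalarMulMul_le a X b := by
    have e : scalarMulMul a X b = a * X * b := by
      ext k l
      simp only [scalarMulMul, Matrix.of_apply, Matrix.mul_apply, Finset.sum_mul, smul_eq_mul]
      rw [Finset.sum_comm]
      exact Finset.sum_congr rfl fun _ _ => Finset.sum_congr rfl fun _ _ => by ring
    rw [e, l2Norm_eq, l2Norm_eq]
    exact (Matrix.l2_opNorm_mul (a * X) b).trans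
      (mul_le_mul_of_nonneg_right (Matrix.l2_opNorm_mul a X) (norm_nonneg b))

lemma mnorm_complex {ι : Type} [Fintype ι] [DecidableEq ι] (X : Matrix ι ι ℂ) : mnorm X = ‖X‖ :=
  l2Norm_eq X

section quotient

lemma quotient_lift {V : Type*} [AddCommGroup V] [Module ℂ V] (S : Submodule ℂ V) {ι : Type}
    (X : Matrix ι ι (V ⧸ S)) : ∃ Y : Matrix ι ι V, Y.map S.mkQ = X := by
  choose Y hY using fun i j => S.mkQ_surjective (X i j)
  exact ⟨Matrix.of Y, by ext i j; exact hY i j⟩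

variable {V : Type*} [NormedAddCommGroup V] [NormedSpace ℂ V] [OperatorSpace V]
  (S : Submodule ℂ V) {ι : Type} [Fintype ι]

/-- The quotient norm on matrices over `V ⧸ S`. -/
def quotientNorm (X : Matrix ι ι (V ⧸ S)) : ℝ :=
  sInf {r | ∃ Y : Matrix ι ι V, Y.map S.mkQ = X ∧ mnorm Y = r}

lemma quotientNorm_le (Y : Matrix ι ι V) : quotientNorm S (Y.map S.mkQ) ≤ mnorm Y :=
  csInf_le ⟨0, by rintro _ ⟨Y, -, rfl⟩; exact mnorm_nonneg Y⟩ ⟨Y, rfl, rfl⟩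

lemma le_quotientNorm (X : Matrix ι ι (V ⧸ S)) {c : ℝ}
    (h : ∀ Y : Matrix ι ι V, Y.map S.mkQ = X → c ≤ mnorm Y) : c ≤ quotientNorm S X := by
  obtain ⟨Y, hY⟩ := quotient_lift S X
  exact le_csInf ⟨_, Y, hY, rfl⟩ (by rintro _ ⟨Y, hY, rfl⟩; exact h Y hY)

lemma exists_lt_quotientNorm (X : Matrix ι ι (V ⧸ S)) {ε : ℝ} (hε : 0 < ε) :
    ∃ Y : Matrix ι ι V, Y.map S.mkQ = X ∧ mnorm Y < quotientNorm S X + ε := by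
  by_contra! h
  have := le_quotientNorm S X h
  linarith

/-- The quotient of an operator space by a closed subspace: `M_n(V ⧸ S) = M_n(V) ⧸ M_n(S)`. -/
instance quotient [IsClosed (S : Set V)] : OperatorSpace (V ⧸ S) where
  mnorm X := quotientNorm S X
  mnorm_add_le X X' := by
    refine le_of_forall_pos_le_add fun ε hε => ?_
    obtain ⟨Y, rfl, hY⟩ := exists_lt_quotientNorm S X (half_pos hε)
    obtain ⟨Y', rfl, hY'⟩ := exists_lt_quotientNorm S X' (half_pos hε)
    rw [← Matrix.map_add _ (map_add _)]
    have := (quotientNorm_le S (Y + Y')).trans (mnorm_add_le Y Y')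
    linarith
  mnorm_one_by_one v := by
    apply le_antisymm
    · refine le_of_forall_pos_le_add fun ε hε => ?_
      obtain ⟨m, rfl, hm⟩ := Submodule.Quotient.norm_mk_lt v hε
      have := quotientNorm_le S (Matrix.of fun _ _ : Unit => m)
      rw [mnorm_one_by_one] at this
      exact this.trans hm.le
    · refine le_quotientNorm S _ fun Y hY => ?_
      have h1 : S.mkQ (Y () ()) = v := congrFun (congrFun hY ()) ()
      rw [← h1]
      exact (Submodule.Quotient.norm_mk_le (S := S) (Y () ())).trans (norm_entry_le Y () ())
  mnorm_fromBlocks X X' := by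
    apply le_antisymm
    · refine le_of_forall_pos_le_add fun ε hε => ?_
      obtain ⟨Y, rfl, hY⟩ := exists_lt_quotientNorm S X hε
      obtain ⟨Y', rfl, hY'⟩ := exists_lt_quotientNorm S X' hε
      have h := quotientNorm_le S (Matrix.fromBlocks Y 0 0 Y')
      rw [mnorm_fromBlocks, Matrix.fromBlocks_map, Matrix.map_zero _ (map_zero _),
        Matrix.map_zero _ (map_zero _)] at h
      refine h.trans (max_le ?_ ?_)
      · exact hY.le.trans (add_le_add_left (le_max_left _ _) ε)
      · exact hY'.le.trans (add_le_add_left (le_max_right _ _) ε)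
    · refine le_quotientNorm S _ fun Y hY => max_le ?_ ?_
      · have h := quotientNorm_le S (Y.submatrix Sum.inl Sum.inl)
        have e : (Y.submatrix Sum.inl Sum.inl).map S.mkQ = X := by
          ext i j; exact congrFun (congrFun hY (Sum.inl i)) (Sum.inl j)
        rw [e] at h
        exact h.trans (mnorm_submatrix_le _ _ Sum.inl_injective Sum.inl_injective Y)
      · have h := quotientNorm_le S (Y.submatrix Sum.inr Sum.inr)
        have e : (Y.submatrix Sum.inr Sum.inr).map S.mkQ = X' := by
          ext i j; exact congrFun (congrFun hY (Sum.inr i)) (Sum.inr j)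
        rw [e] at h
        exact h.trans (mnorm_submatrix_le _ _ Sum.inr_injective Sum.inr_injective Y)
  mnorm_scalarMulMul_le a X b := by
    refine le_of_forall_pos_le_add fun ε hε => ?_
    obtain ⟨Y, rfl, hY⟩ := exists_lt_quotientNorm S X
      (div_pos hε (show 0 < ‖a‖ * ‖b‖ + 1 by positivity))
    have e : scalarMulMul a (Y.map S.mkQ) b = (scalarMulMul a Y b).map S.mkQ := by
      ext; simp only [scalarMulMul, Matrix.of_apply, Matrix.map_apply, map_sum, map_smul]
    rw [e]
    refine (quotientNorm_le S _).trans ((mnorm_scalarMulMul_le a Y b).trans ?_)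
    set q := quotientNorm S (Y.map S.mkQ)
    have hd : ‖a‖ * ‖b‖ * (ε / (‖a‖ * ‖b‖ + 1)) ≤ ε := by
      rw [mul_div_assoc', div_le_iff₀ (by positivity)]
      nlinarith [mul_nonneg (norm_nonneg a) (norm_nonneg b)]
    calc ‖a‖ * mnorm Y * ‖b‖ ≤ ‖a‖ * (q + ε / (‖a‖ * ‖b‖ + 1)) * ‖b‖ := by gcongr
      _ = ‖a‖ * q * ‖b‖ + ‖a‖ * ‖b‖ * (ε / (‖a‖ * ‖b‖ + 1)) := by ring
      _ ≤ _ := by gcongr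

end quotient

end OperatorSpace

open OperatorSpace

/-! ### Completely bounded maps -/

section cb

variable (V W : Type*) [NormedAddCommGroup V] [NormedSpace ℂ V] [OperatorSpace V]
  [NormedAddCommGroup W] [NormedSpace ℂ W] [OperatorSpace W]

/-- The subspace of completely bounded linear maps. -/
def cbMaps : Submodule ℂ (V →ₗ[ℂ] W) where
  carrier := {φ | ∃ C : ℝ, ∀ (n : ℕ) (x : Matrix (Fin n) (Fin n) V),
    mnorm (x.map φ) ≤ C * mnorm x}
  zero_mem' := ⟨0, fun n x => by
    have : x.map (0 : V →ₗ[ℂ] W) = 0 := by ext; simp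
    rw [this, mnorm_zero, zero_mul]⟩
  add_mem' := by
    rintro φ ψ ⟨C, hC⟩ ⟨D, hD⟩
    refine ⟨C + D, fun n x => ?_⟩
    have : x.map (φ + ψ) = x.map φ + x.map ψ := by ext; simp
    rw [this, add_mul]
    exact (mnorm_add_le _ _).trans (add_le_add (hC n x) (hD n x))
  smul_mem' := by
    rintro c φ ⟨C, hC⟩
    refine ⟨‖c‖ * C, fun n x => ?_⟩
    have : x.map (c • φ) = c • x.map φ := by ext; simp
    rw [this, mul_assoc]
    exact (mnorm_smul_le _ _).trans (mul_le_mul_of_nonneg_left (hC n x) (norm_nonneg c))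

/-- The space `CB(V, W)` of completely bounded linear maps `V → W`. -/
def CB : Type _ := cbMaps V W

instance : AddCommGroup (CB V W) := inferInstanceAs (AddCommGroup (cbMaps V W))

instance : Module ℂ (CB V W) := inferInstanceAs (Module ℂ (cbMaps V W))

end cb

namespace CB

variable {V W : Type*} [NormedAddCommGroup V] [NormedSpace ℂ V] [OperatorSpace V]
  [NormedAddCommGroup W] [NormedSpace ℂ W] [OperatorSpace W]

/-- The underlying linear map. -/
def toLin (φ : CB V W) : V →ₗ[ℂ] W := Subtype.val φ

instance : CoeFun (CB V W) fun _ => V → W := ⟨fun φ => φ.toLin⟩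

lemma toLin_injective : Function.Injective (toLin : CB V W → V →ₗ[ℂ] W) := Subtype.val_injective

/-- Construct a completely bounded map from a linear map and a bound. -/
def mk (φ : V →ₗ[ℂ] W) (C : ℝ)
    (h : ∀ (n : ℕ) (x : Matrix (Fin n) (Fin n) V), mnorm (x.map φ) ≤ C * mnorm x) : CB V W :=
  ⟨φ, C, h⟩

lemma coe_add (φ ψ : CB V W) (v : V) : (φ + ψ) v = φ v + ψ v := rfl
lemma coe_smul (c : ℂ) (φ : CB V W) (v : V) : (c • φ) v = c • φ v := rfl

variable (V) in
/-- Pairs of a natural number `n` and a matrix in the unit ball of `M_n(V)`. -/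
abbrev Ball := Σ n : ℕ, {x : Matrix (Fin n) (Fin n) V // mnorm x ≤ 1}

instance : Nonempty (Ball V) := ⟨⟨0, 0, mnorm_zero.le.trans zero_le_one⟩⟩

/-- Application of completely bounded maps to a matrix of the unit ball. -/
def test (t : Ball V) : CB V W →ₗ[ℂ] Matrix (Fin t.1) (Fin t.1) W where
  toFun φ := t.2.1.map φ
  map_add' φ ψ := by ext; rfl
  map_smul' c φ := by ext; rfl

lemma test_bdd (φ : CB V W) : BddAbove (Set.range fun t : Ball V => mnorm (test t φ)) := by
  obtain ⟨C, hC⟩ := Subtype.property φ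
  refine ⟨|C|, ?_⟩
  rintro _ ⟨⟨n, x, hx⟩, rfl⟩
  refine (hC n x).trans ((mul_le_mul_of_nonneg_right (le_abs_self C) (mnorm_nonneg x)).trans ?_)
  exact mul_le_of_le_one_right (abs_nonneg C) hx

/-- The completely bounded norm: `‖φ‖_cb = sup ‖φ_n(x)‖` over all `n` and all `x` in the unit
ball of `M_n(V)`. -/
def cbNorm (φ : CB V W) : ℝ := ⨆ t : Ball V, mnorm (test t φ)

lemma cbNorm_nonneg (φ : CB V W) : 0 ≤ cbNorm φ := Real.iSup_nonneg fun _ => mnorm_nonneg _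

lemma le_cbNorm (φ : CB V W) {n : ℕ} (x : Matrix (Fin n) (Fin n) V) :
    mnorm (x.map φ) ≤ cbNorm φ * mnorm x := by
  refine le_of_forall_pos_le_add fun ε hε => ?_
  set c := cbNorm φ with hc
  have hc0 : 0 ≤ c := cbNorm_nonneg φ
  set r := mnorm x + ε / (c + 1) with hr
  have hr0 : 0 < r := add_pos_of_nonneg_of_pos (mnorm_nonneg x) (by positivity)
  have hx : mnorm (((r⁻¹ : ℝ) : ℂ) • x) ≤ 1 := by
    refine (mnorm_smul_le _ _).trans ?_
    rw [Complex.norm_real, Real.norm_of_nonneg (by positivity), inv_mul_le_one₀ hr0]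
    exact le_add_of_nonneg_right (by positivity)
  have h1 : mnorm ((((r⁻¹ : ℝ) : ℂ) • x).map φ) ≤ c := le_ciSup (test_bdd φ) ⟨n, _, hx⟩
  have e : x.map φ = ((r : ℝ) : ℂ) • (((r⁻¹ : ℝ) : ℂ) • x).map φ := by
    ext i j
    simp only [Matrix.map_apply, Matrix.smul_apply, map_smul, smul_smul]
    rw [← Complex.ofReal_mul, mul_inv_cancel₀ hr0.ne']
    simp
  rw [e]
  refine (mnorm_smul_le _ _).trans ?_
  rw [Complex.norm_real, Real.norm_of_nonneg hr0.le]
  refine (mul_le_mul_of_nonneg_left h1 hr0.le).trans ?_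
  have : ε / (c + 1) * c ≤ ε := by
    rw [div_mul_eq_mul_div, div_le_iff₀ (by positivity)]
    nlinarith
  rw [hr]
  nlinarith

lemma cbNorm_le (φ : CB V W) {C : ℝ} (hC : 0 ≤ C)
    (h : ∀ (n : ℕ) (x : Matrix (Fin n) (Fin n) V), mnorm (x.map φ) ≤ C * mnorm x) :
    cbNorm φ ≤ C :=
  ciSup_le fun t => (h t.1 t.2.1).trans (mul_le_of_le_one_right hC t.2.2)

lemma norm_apply_le_cbNorm (φ : CB V W) (v : V) : ‖φ v‖ ≤ cbNorm φ * ‖v‖ := by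
  have h := le_cbNorm φ (Matrix.of fun _ _ : Fin 1 => v)
  have hv : mnorm (Matrix.of fun _ _ : Fin 1 => v) = ‖v‖ := by
    rw [← mnorm_one_by_one, ← mnorm_reindex (Equiv.ofUnique Unit (Fin 1))]
    rfl
  rw [hv] at h
  exact (norm_entry_le ((Matrix.of fun _ _ : Fin 1 => v).map φ) 0 0).trans h

lemma cbNorm_add_le (φ ψ : CB V W) : cbNorm (φ + ψ) ≤ cbNorm φ + cbNorm ψ := by
  refine ciSup_le fun t => ?_
  rw [map_add]
  exact (mnorm_add_le _ _).trans (add_le_add (le_ciSup (test_bdd φ) t) (le_ciSup (test_bdd ψ) t))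

lemma cbNorm_smul_le (c : ℂ) (φ : CB V W) : cbNorm (c • φ) ≤ ‖c‖ * cbNorm φ := by
  refine ciSup_le fun t => ?_
  rw [map_smul]
  exact (mnorm_smul_le _ _).trans (mul_le_mul_of_nonneg_left (le_ciSup (test_bdd φ) t)
    (norm_nonneg c))

instance : NormedAddCommGroup (CB V W) :=
  AddGroupNorm.toNormedAddCommGroup
    { toFun := cbNorm
      map_zero' := le_antisymm (by simpa using cbNorm_smul_le (0 : ℂ) (0 : CB V W))
        (cbNorm_nonneg _)
      add_le' := cbNorm_add_le
      neg' := fun φ => by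
        have h : ∀ ψ : CB V W, cbNorm (-ψ) ≤ cbNorm ψ := fun ψ => by
          rw [← neg_one_smul ℂ ψ]
          simpa using cbNorm_smul_le (-1 : ℂ) ψ
        exact le_antisymm (h φ) (by simpa using h (-φ))
      eq_zero_of_map_eq_zero' := fun φ h => by
        have h : cbNorm φ = 0 := h
        refine toLin_injective (LinearMap.ext fun v => ?_)
        have := norm_apply_le_cbNorm φ v
        rw [h, zero_mul] at this
        exact norm_le_zero_iff.1 this }

lemma norm_def (φ : CB V W) : ‖φ‖ = ⨆ t : Ball V, mnorm (test t φ) := rfl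

instance : NormedSpace ℂ (CB V W) where
  norm_smul_le := cbNorm_smul_le

/-- `CB(V, W)` is an operator space: `‖[φ_ij]‖` is the supremum of `‖[φ_ij(x_kl)]‖` over all `n`
and all `[x_kl]` in the unit ball of `M_n(V)`, that is, `M_m(CB(V, W)) = CB(V, M_m(W))`. -/
instance : OperatorSpace (CB V W) :=
  OperatorSpace.ofTests (T := Ball V) (fun t => Fin t.1) test test_bdd norm_def

lemma norm_apply_le (φ : CB V W) (v : V) : ‖φ v‖ ≤ ‖φ‖ * ‖v‖ := norm_apply_le_cbNorm φ v

lemma mnorm_map_apply_le {ι : Type} [Fintype ι] (X : Matrix ι ι (CB V W)) (v : V) :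
    mnorm (X.map fun φ => φ v) ≤ mnorm X * ‖v‖ := by
  have hc : 0 ≤ mnorm X := mnorm_nonneg X
  refine le_of_forall_pos_le_add fun ε hε => ?_
  set r := ‖v‖ + ε / (mnorm X + 1) with hr
  have hr0 : 0 < r := add_pos_of_nonneg_of_pos (norm_nonneg v) (by positivity)
  have hv : ∀ w : V, mnorm (Matrix.of fun _ _ : Fin 1 => w) = ‖w‖ := fun w => by
    rw [← mnorm_one_by_one, ← mnorm_reindex (Equiv.ofUnique Unit (Fin 1))]
    rfl
  let t : Ball V := ⟨1, Matrix.of fun _ _ : Fin 1 => ((r⁻¹ : ℝ) : ℂ) • v, by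
    rw [hv, norm_smul, Complex.norm_real, Real.norm_of_nonneg (by positivity),
      inv_mul_le_one₀ hr0]
    exact le_add_of_nonneg_right (by positivity)⟩
  have h1 : mnorm (testMatrix (fun t : Ball V => Fin t.1) (test (V := V) (W := W)) t X) ≤ mnorm X :=
    le_ciSup (testMatrix_bdd (fun t : Ball V => Fin t.1) (test (V := V) (W := W)) test_bdd X) t
  have e : X.map (fun φ => φ v) = ((r : ℝ) : ℂ) •
      (testMatrix (fun t : Ball V => Fin t.1) (test (V := V) (W := W)) t X).submatrix
        (fun i => (i, (0 : Fin 1))) (fun i => (i, (0 : Fin 1))) := by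
    ext i j
    change X i j v = ((r : ℝ) : ℂ) • X i j (((r⁻¹ : ℝ) : ℂ) • v)
    rw [map_smul, smul_smul, ← Complex.ofReal_mul, mul_inv_cancel₀ hr0.ne', Complex.ofReal_one,
      one_smul]
  have inj : Function.Injective fun i : ι => (i, (0 : Fin 1)) := fun i j h => (Prod.ext_iff.1 h).1
  rw [e]
  refine (mnorm_smul_le _ _).trans ?_
  rw [Complex.norm_real, Real.norm_of_nonneg hr0.le]
  refine (mul_le_mul_of_nonneg_left ((mnorm_submatrix_le _ _ inj inj _).trans h1) hr0.le).trans ?_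
  have : ε / (mnorm X + 1) * mnorm X ≤ ε := by
    rw [div_mul_eq_mul_div, div_le_iff₀ (by positivity)]
    nlinarith
  rw [hr]
  nlinarith

instance [CompleteSpace W] : CompleteSpace (CB V W) := by
  refine Metric.complete_of_cauchySeq_tendsto fun u hu => ?_
  have hp : ∀ v, CauchySeq fun n => u n v := fun v => by
    rw [Metric.cauchySeq_iff'] at hu ⊢
    intro ε hε
    obtain ⟨N, hN⟩ := hu (ε / (‖v‖ + 1)) (by positivity)
    refine ⟨N, fun n hn => ?_⟩
    have h1 := hN n hn
    rw [dist_eq_norm] at h1 ⊢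
    have h2 := norm_apply_le (u n - u N) v
    have h3 : ‖u n - u N‖ * (‖v‖ + 1) < ε := (lt_div_iff₀ (by positivity)).1 h1
    have h4 : (u n - u N) v = u n v - u N v := rfl
    rw [h4] at h2
    nlinarith [norm_nonneg (u n - u N)]
  choose f hf using fun v => cauchySeq_tendsto_of_complete (hp v)
  obtain ⟨φ, hφf⟩ : ∃ φ : V →ₗ[ℂ] W, ∀ v, φ v = f v := ⟨
    { toFun := f
      map_add' := fun v w => tendsto_nhds_unique (hf (v + w))
        (by simpa only [map_add] using (hf v).add (hf w))
      map_smul' := fun c v => tendsto_nhds_unique (hf (c • v))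
        (by simpa only [map_smul, RingHom.id_apply] using (hf v).const_smul c) }, fun _ => rfl⟩
  have key : ∀ (N : ℕ) (ε : ℝ), (∀ n ≥ N, ‖u n - u N‖ ≤ ε) →
      ∀ (k : ℕ) (x : Matrix (Fin k) (Fin k) V), mnorm (x.map (φ - (u N).toLin)) ≤ ε * mnorm x := by
    intro N ε h k x
    have hlim : Filter.Tendsto (fun n => ε * mnorm x + ∑ i, ∑ j, ‖φ (x i j) - u n (x i j)‖)
        Filter.atTop (nhds (ε * mnorm x + ∑ i : Fin k, ∑ j : Fin k, 0)) := by
      refine tendsto_const_nhds.add (tendsto_finsetSum _ fun i _ => tendsto_finsetSum _ fun j _ => ?_)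
      have := (tendsto_const_nhds (x := φ (x i j))).sub (hf (x i j))
      rw [hφf, sub_self] at this
      rw [hφf]
      simpa using this.norm
    simp only [Finset.sum_const_zero, add_zero] at hlim
    refine ge_of_tendsto hlim (Filter.eventually_atTop.2 ⟨N, fun n hn => ?_⟩)
    have e : x.map (φ - (u N).toLin) = x.map (u n - u N) + x.map (φ - (u n).toLin) := by
      ext i j
      change φ _ - u N _ = (u n _ - u N _) + (φ _ - u n _)
      abel
    rw [e]
    refine (mnorm_add_le _ _).trans (add_le_add ((le_cbNorm _ _).trans ?_) (mnorm_le_sum _))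
    exact mul_le_mul_of_nonneg_right (h n hn) (mnorm_nonneg x)
  have hcau : ∀ ε > 0, ∃ N, ∀ n ≥ N, ‖u n - u N‖ ≤ ε := fun ε hε => by
    obtain ⟨N, hN⟩ := Metric.cauchySeq_iff'.1 hu ε hε
    exact ⟨N, fun n hn => by rw [← dist_eq_norm]; exact (hN n hn).le⟩
  obtain ⟨N, hN⟩ := hcau 1 one_pos
  have hφ : φ ∈ cbMaps V W := by
    have h1 : φ - (u N).toLin ∈ cbMaps V W := ⟨1, key N 1 hN⟩
    have h2 := (cbMaps V W).add_mem h1 (Subtype.property (u N))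
    have h3 : φ - (u N).toLin + Subtype.val (u N) = φ := sub_add_cancel φ (u N).toLin
    rwa [h3] at h2
  obtain ⟨ψ, hψ⟩ : ∃ ψ : CB V W, ψ.toLin = φ := ⟨⟨φ, hφ⟩, rfl⟩
  subst hψ
  refine ⟨ψ, ?_⟩
  rw [Metric.tendsto_atTop]
  intro ε hε
  obtain ⟨N, hN⟩ := hcau (ε / 3) (by positivity)
  refine ⟨N, fun n hn => ?_⟩
  have h1 : ‖ψ - u N‖ ≤ ε / 3 :=
    cbNorm_le _ (by positivity) (key N (ε / 3) hN)
  rw [dist_eq_norm]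
  calc ‖u n - ψ‖ = ‖(u n - u N) - (ψ - u N)‖ := by congr 1; abel
    _ ≤ ‖u n - u N‖ + ‖ψ - u N‖ := norm_sub_le _ _
    _ < ε := by linarith [hN n hn]

/-- Composition of completely bounded maps makes `CB(V, V)` a Banach algebra. -/
instance : Mul (CB V V) where
  mul φ ψ := mk (φ.toLin ∘ₗ ψ.toLin) (‖φ‖ * ‖ψ‖) fun n x => by
    rw [mul_assoc]
    exact (le_cbNorm φ (x.map ψ)).trans
      (mul_le_mul_of_nonneg_left (le_cbNorm ψ x) (cbNorm_nonneg φ))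

lemma mul_apply (φ ψ : CB V V) (v : V) : (φ * ψ) v = φ (ψ v) := rfl

lemma ext {φ ψ : CB V W} (h : ∀ v, φ v = ψ v) : φ = ψ := toLin_injective (LinearMap.ext h)

instance : NonUnitalNormedRing (CB V V) :=
  { (inferInstance : NormedAddCommGroup (CB V V)), (inferInstance : Mul (CB V V)) with
    left_distrib := fun a _ _ => ext fun _ => map_add a.toLin _ _
    right_distrib := fun _ _ _ => rfl
    zero_mul := fun _ => rfl
    mul_zero := fun a => ext fun _ => map_zero a.toLin
    mul_assoc := fun _ _ _ => rfl
    norm_mul_le := fun φ ψ => cbNorm_le _ (mul_nonneg (cbNorm_nonneg φ) (cbNorm_nonneg ψ))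
      fun n x => by
        rw [mul_assoc]
        exact (le_cbNorm φ (x.map ψ)).trans
          (mul_le_mul_of_nonneg_left (le_cbNorm ψ x) (cbNorm_nonneg φ)) }

instance : IsScalarTower ℂ (CB V V) (CB V V) := ⟨fun _ _ _ => rfl⟩

instance : SMulCommClass ℂ (CB V V) (CB V V) :=
  ⟨fun c φ _ => ext fun _ => (map_smul φ.toLin c _).symm⟩

end CB

/-! ### The projective tensor product -/

section tensor

variable (V W : Type*) [NormedAddCommGroup V] [NormedSpace ℂ V] [OperatorSpace V]
  [NormedAddCommGroup W] [NormedSpace ℂ W] [OperatorSpace W]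

/-- The operator space dual `V* = CB(V, ℂ)`. -/
abbrev OpDual := CB V ℂ

variable {V W} in
/-- The elementary tensor `v ⊗ w` as the functional `Φ ↦ Φ(v)(w)` on `CB(V, W*)`. -/
def elementaryTensor (v : V) (w : W) : OpDual (CB V (OpDual W)) :=
  CB.mk { toFun := fun Φ => Φ v w, map_add' := fun _ _ => rfl, map_smul' := fun _ _ => rfl }
    (‖v‖ * ‖w‖) fun n Φ => by
      have h1 := CB.mnorm_map_apply_le Φ v
      have h2 := CB.mnorm_map_apply_le (Φ.map fun φ => φ v) w
      calc _ ≤ mnorm (Φ.map fun φ => φ v) * ‖w‖ := h2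
        _ ≤ mnorm Φ * ‖v‖ * ‖w‖ := by gcongr
        _ = _ := by ring

/-- The closed linear span of the elementary tensors. -/
def tensorSubspace : Submodule ℂ (OpDual (CB V (OpDual W))) :=
  (Submodule.span ℂ (Set.range fun p : V × W => elementaryTensor p.1 p.2)).topologicalClosure

/-- The operator space projective tensor product `V ⊗̂ W`: the completion of `V ⊗ W` in the matrix
norms given by the duality `(V ⊗̂ W)* = CB(V, W*)`, that is, the closed linear span of the
elementary tensors in the operator space dual of `CB(V, W*)`. -/
def ProjTensor : Type _ := tensorSubspace V W

instance : NormedAddCommGroup (ProjTensor V W) :=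
  inferInstanceAs (NormedAddCommGroup (tensorSubspace V W))

instance : NormedSpace ℂ (ProjTensor V W) := inferInstanceAs (NormedSpace ℂ (tensorSubspace V W))

instance : OperatorSpace (ProjTensor V W) := inferInstanceAs (OperatorSpace (tensorSubspace V W))

instance : CompleteSpace (ProjTensor V W) :=
  (Submodule.isClosed_topologicalClosure _).completeSpace_coe

variable {V W} in
/-- The elementary tensor `v ⊗ w` in `V ⊗̂ W`. -/
def ProjTensor.tmul (v : V) (w : W) : ProjTensor V W :=
  ⟨elementaryTensor v w, Submodule.le_topologicalClosure _ (Submodule.subset_span ⟨(v, w), rfl⟩)⟩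

end tensor

/-! ### Completely contractive Banach algebras and their modules -/

/-- The Banach algebra `A` with its operator space structure is a completely contractive Banach
algebra: the multiplication extends to a complete contraction `A ⊗̂ A → A`. -/
def IsCompletelyContractive (A : Type*) [NonUnitalNormedRing A] [NormedSpace ℂ A]
    [IsScalarTower ℂ A A] [SMulCommClass ℂ A A] [CompleteSpace A] [OperatorSpace A] : Prop :=
  ∃ m : CB (ProjTensor A A) A, ‖m‖ ≤ 1 ∧ ∀ a b : A, m (ProjTensor.tmul a b) = a * b

section modules

variable (A : Type*) [NonUnitalNormedRing A] [NormedSpace ℂ A] [OperatorSpace A]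

/-- A completely bounded left `A`-module structure on `X`: an action of the algebra `A` on `X` which
extends to a completely bounded map `π : A ⊗̂ X → X`. -/
structure CBLeftModule (X : Type*) [NormedAddCommGroup X] [NormedSpace ℂ X] [OperatorSpace X] where
  act : A →ₗ[ℂ] X →ₗ[ℂ] X
  mul_act : ∀ (a b : A) (x : X), act (a * b) x = act a (act b x)
  π : CB (ProjTensor A X) X
  π_tmul : ∀ (a : A) (x : X), π (ProjTensor.tmul a x) = act a x

variable {A} {X Y : Type*} [NormedAddCommGroup X] [NormedSpace ℂ X] [OperatorSpace X]
  [NormedAddCommGroup Y] [NormedSpace ℂ Y] [OperatorSpace Y]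

/-- A completely bounded map is a left `A`-module map. -/
def IsModuleMap (M : CBLeftModule A X) (N : CBLeftModule A Y) (T : CB X Y) : Prop :=
  ∀ (a : A) (x : X), T (M.act a x) = N.act a (T x)

/-- A subspace is completely complemented: it is the range of a completely bounded projection. -/
def IsCompletelyComplemented (S : Submodule ℂ X) : Prop :=
  ∃ P : CB X X, (∀ x, P x ∈ S) ∧ ∀ x ∈ S, P x = x

/-- A completely bounded map is admissible: its kernel is completely complemented, and its range is
closed and completely complemented. -/
def IsAdmissible (T : CB X Y) : Prop :=
  IsCompletelyComplemented (LinearMap.ker T.toLin) ∧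
    IsClosed (LinearMap.range T.toLin : Set Y) ∧ IsCompletelyComplemented (LinearMap.range T.toLin)

/-- Operator projectivity in `A`-mod: module maps from `X` lift along admissible surjective module
maps between complete completely bounded left `A`-modules. -/
def IsOperatorProjective.{u₁, u₂, u₃} {A : Type u₁} [NonUnitalNormedRing A] [NormedSpace ℂ A]
    [IsScalarTower ℂ A A] [SMulCommClass ℂ A A] [CompleteSpace A] [OperatorSpace A] {X : Type u₂} [NormedAddCommGroup X] [NormedSpace ℂ X] [OperatorSpace X]
    [CompleteSpace X] (M : CBLeftModule A X) : Prop :=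
  ∀ (E F : Type u₃) [NormedAddCommGroup E] [NormedSpace ℂ E] [OperatorSpace E] [CompleteSpace E]
    [NormedAddCommGroup F] [NormedSpace ℂ F] [OperatorSpace F] [CompleteSpace F]
    (ME : CBLeftModule A E) (MF : CBLeftModule A F) (T : CB E F),
    IsModuleMap ME MF T → IsAdmissible T → Function.Surjective T →
    ∀ S : CB X F, IsModuleMap M MF S → ∃ R : CB X E, IsModuleMap M ME R ∧ ∀ x, T (R x) = S x

end modules

/-! ### The spaces attached to a discrete group -/

section group

variable (G : Type*)

/-- The Hilbert space `ℓ²(G)`. -/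
abbrev EllTwo := lp (fun _ : G => ℂ) 2

/-- The Banach space `ℓ¹(G)`. -/
abbrev EllOne := lp (fun _ : G => ℂ) 1

variable {G} [Group G]

/-- The left regular representation: `(λ(x) f)(y) = f(x⁻¹ y)`. -/
def leftRegular (x : G) : EllTwo G →L[ℂ] EllTwo G :=
  LinearMap.mkContinuous
    { toFun := fun f => ⟨fun y => f (x⁻¹ * y), by
        refine memℓp_gen ?_
        exact ((lp.memℓp f).summable (by simp)).comp_injective (mul_right_injective x⁻¹)⟩
      map_add' := fun f g => rfl
      map_smul' := fun c f => rfl } 1 (fun f => by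
    rw [one_mul]
    refine le_of_eq ?_
    rw [lp.norm_eq_tsum_rpow (by simp), lp.norm_eq_tsum_rpow (by simp)]
    congr 1
    exact (Equiv.mulLeft x⁻¹).tsum_eq fun y => ‖f y‖ ^ (2 : ENNReal).toReal)

variable (G) in
/-- The closure of the span of the operators `λ(x)` in the weak operator topology of `B(ℓ²(G))`. -/
def vnSubspace : Submodule ℂ (EllTwo G →L[ℂ] EllTwo G) :=
  ((Submodule.span ℂ (Set.range (leftRegular (G := G)))).comap
    (ContinuousLinearMapWOT.linearEquiv (σ := RingHom.id ℂ) (E := EllTwo G) (F := EllTwo G)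
      ℂ).toLinearMap).topologicalClosure.comap
    (ContinuousLinearMapWOT.linearEquiv (σ := RingHom.id ℂ) (E := EllTwo G) (F := EllTwo G)
      ℂ).symm.toLinearMap

variable (G) in
/-- The group von Neumann algebra `VN(G)`, as a subspace of `B(ℓ²(G))`. -/
def VN : Type _ := vnSubspace G

instance : NormedAddCommGroup (VN G) := inferInstanceAs (NormedAddCommGroup (vnSubspace G))

instance : NormedSpace ℂ (VN G) := inferInstanceAs (NormedSpace ℂ (vnSubspace G))

instance : OperatorSpace (VN G) := inferInstanceAs (OperatorSpace (vnSubspace G))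

/-- The operator on `ℓ²(G)` underlying an element of `VN(G)`. -/
def VN.op (T : VN G) : EllTwo G →L[ℂ] EllTwo G := Subtype.val T

/-- `λ(x)` as an element of `VN(G)`. -/
def VN.of (x : G) : VN G :=
  ⟨leftRegular x, Submodule.le_topologicalClosure _ (Submodule.subset_span ⟨x, rfl⟩)⟩

/-- The vector functional `T ↦ ⟨T ξ, η⟩` on `VN(G)`. -/
def vectorFunctional (ξ η : EllTwo G) : OpDual (VN G) :=
  CB.mk
    { toFun := fun T => inner ℂ η (T.op ξ)
      map_add' := fun S T => inner_add_right η (S.op ξ) (T.op ξ)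
      map_smul' := fun c T => inner_smul_right η (T.op ξ) c } (‖ξ‖ * ‖η‖) fun n T => by
    rw [mnorm_complex]
    refine l2_le _ (mul_nonneg (by positivity) (mnorm_nonneg T)) fun c => ?_
    have h1 : ∀ k, ‖∑ l, (inner ℂ η ((T k l).op ξ) : ℂ) * c l‖ ^ 2 ≤
        ‖η‖ ^ 2 * ‖∑ l, (T k l).op (c l • ξ)‖ ^ 2 := fun k => by
      have : ∑ l, (inner ℂ η ((T k l).op ξ) : ℂ) * c l = inner ℂ η (∑ l, (T k l).op (c l • ξ)) := by
        rw [inner_sum]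
        refine Finset.sum_congr rfl fun l _ => ?_
        rw [map_smul, inner_smul_right, mul_comm]
      rw [this, ← mul_pow]
      exact pow_le_pow_left₀ (norm_nonneg _) (norm_inner_le_norm _ _) 2
    refine (Finset.sum_le_sum fun k _ => h1 k).trans ?_
    rw [← Finset.mul_sum]
    refine (mul_le_mul_of_nonneg_left (matrixOperator_sq (T.map VN.op) fun l => c l • ξ)
      (by positivity)).trans (le_of_eq ?_)
    have h2 : ‖matrixOperator (T.map VN.op)‖ = mnorm T := rfl
    rw [h2]
    simp only [norm_smul, mul_pow, ← Finset.sum_mul]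
    ring

variable (G) in
/-- The closed linear span of the vector functionals in the dual of `VN(G)`. -/
def predualSubspace : Submodule ℂ (OpDual (VN G)) :=
  (Submodule.span ℂ (Set.range fun p : EllTwo G × EllTwo G =>
    vectorFunctional p.1 p.2)).topologicalClosure

variable (G) in
/-- The predual `VN(G)_*`, the space of normal functionals on `VN(G)`: the closed linear span of the
vector functionals in the dual of `VN(G)`. -/
def VNPredual : Type _ := predualSubspace G

instance : NormedAddCommGroup (VNPredual G) :=
  inferInstanceAs (NormedAddCommGroup (predualSubspace G))

instance : NormedSpace ℂ (VNPredual G) := inferInstanceAs (NormedSpace ℂ (predualSubspace G))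

instance : OperatorSpace (VNPredual G) := inferInstanceAs (OperatorSpace (predualSubspace G))

instance : CompleteSpace (VNPredual G) :=
  (Submodule.isClosed_topologicalClosure _).completeSpace_coe

/-- The functional on `VN(G)` underlying an element of the predual. -/
def VNPredual.functional (φ : VNPredual G) : OpDual (VN G) := Subtype.val φ

variable (G) in
/-- The map `φ ↦ (x ↦ φ(λ(x)))`. -/
def predualToFun : VNPredual G →ₗ[ℂ] (G → ℂ) where
  toFun φ x := φ.functional (VN.of x)
  map_add' _ _ := rfl
  map_smul' _ _ := rfl

lemma predualToFun_le (φ : VNPredual G) (x : G) : ‖predualToFun G φ x‖ ≤ ‖VN.of x‖ * ‖φ‖ := by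
  rw [mul_comm]
  exact CB.norm_apply_le φ.functional (VN.of x)

instance : IsClosed ((LinearMap.ker (predualToFun G)) : Set (VNPredual G)) := by
  have : ((LinearMap.ker (predualToFun G)) : Set (VNPredual G)) =
      ⋂ x : G, {φ | predualToFun G φ x = 0} := by
    ext φ
    simp only [SetLike.mem_coe, LinearMap.mem_ker, Set.mem_iInter, Set.mem_ofPred_eq]
    exact funext_iff
  rw [this]
  refine isClosed_iInter fun x => isClosed_eq ?_ continuous_const
  exact ((LinearMap.proj x ∘ₗ predualToFun G).mkContinuous ‖VN.of x‖ fun φ =>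
    predualToFun_le φ x).continuous

variable (G) in
/-- The Fourier algebra `A(G)`: the space of the functions `x ↦ φ(λ(x))` on `G`, where `φ` runs
through the predual of `VN(G)`, with the matrix norms of that predual. As `VN(G)` is generated by
the operators `λ(x)`, the function determines `φ`, so the subspace divided out here is zero;
dividing it out makes the elements functions by construction. -/
def FourierAlgebra : Type _ := VNPredual G ⧸ LinearMap.ker (predualToFun G)

namespace FourierAlgebra

instance : NormedAddCommGroup (FourierAlgebra G) :=
  inferInstanceAs (NormedAddCommGroup (VNPredual G ⧸ LinearMap.ker (predualToFun G)))

instance : NormedSpace ℂ (FourierAlgebra G) :=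
  inferInstanceAs (NormedSpace ℂ (VNPredual G ⧸ LinearMap.ker (predualToFun G)))

instance : OperatorSpace (FourierAlgebra G) :=
  inferInstanceAs (OperatorSpace (VNPredual G ⧸ LinearMap.ker (predualToFun G)))

instance : CompleteSpace (FourierAlgebra G) :=
  inferInstanceAs (CompleteSpace (VNPredual G ⧸ LinearMap.ker (predualToFun G)))

/-- The elements of `A(G)` as functions on `G`. -/
def toFun : FourierAlgebra G →ₗ[ℂ] (G → ℂ) :=
  (LinearMap.ker (predualToFun G)).liftQ (predualToFun G) le_rfl

instance : CoeFun (FourierAlgebra G) fun _ => G → ℂ := ⟨fun u => toFun u⟩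

lemma toFun_injective : Function.Injective (toFun (G := G)) :=
  LinearMap.ker_eq_bot.1 (Submodule.ker_liftQ_eq_bot _ _ _ le_rfl)

/-- The coefficient function `x ↦ ⟨λ(x) ξ, η⟩` as an element of `A(G)`. -/
def coeff (ξ η : EllTwo G) : FourierAlgebra G :=
  (LinearMap.ker (predualToFun G)).mkQ
    ⟨vectorFunctional ξ η, Submodule.le_topologicalClosure _ (Submodule.subset_span ⟨(ξ, η), rfl⟩)⟩

lemma norm_apply_le (u : FourierAlgebra G) (x : G) : ‖u x‖ ≤ ‖VN.of x‖ * ‖u‖ := by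
  refine le_of_forall_pos_le_add fun ε hε => ?_
  have hε' : 0 < ε / (‖VN.of x‖ + 1) := by positivity
  obtain ⟨φ, hφ, h⟩ := Submodule.Quotient.norm_mk_lt
    (S := LinearMap.ker (predualToFun G)) (x := u) hε'
  have h1 : u x = predualToFun G φ x := by rw [← hφ]; rfl
  rw [h1]
  have h2 : ‖φ‖ ≤ ‖u‖ + ε / (‖VN.of x‖ + 1) := h.le
  refine (predualToFun_le φ x).trans ((mul_le_mul_of_nonneg_left h2 (norm_nonneg _)).trans ?_)
  rw [mul_add]
  gcongr
  rw [mul_div_assoc', div_le_iff₀ (by positivity)]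
  nlinarith [norm_nonneg (VN.of x)]

lemma continuous_apply (x : G) : Continuous fun u : FourierAlgebra G => u x :=
  ((LinearMap.proj x ∘ₗ toFun).mkContinuous ‖VN.of x‖ fun u => norm_apply_le u x).continuous

lemma coeff_apply (ξ η : EllTwo G) (x : G) : coeff ξ η x = inner ℂ η (leftRegular x ξ) := rfl

end FourierAlgebra

/-! ### The algebra `A_cb(G)` -/

variable (G) in
/-- The elements of `A(G)`, as completely bounded operators of multiplication on `A(G)`. -/
def multiplicationOperators : NonUnitalSubalgebra ℂ (CB (FourierAlgebra G) (FourierAlgebra G)) where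
  carrier := {M | ∃ u : FourierAlgebra G, ∀ (v : FourierAlgebra G) (x : G), M v x = u x * v x}
  zero_mem' := ⟨0, fun v x => by
    rw [map_zero, Pi.zero_apply, zero_mul]
    exact congrFun (map_zero FourierAlgebra.toFun) x⟩
  add_mem' := by
    rintro M N ⟨u, hu⟩ ⟨w, hw⟩
    refine ⟨u + w, fun v x => ?_⟩
    rw [CB.coe_add, map_add, map_add, Pi.add_apply, Pi.add_apply, hu, hw, add_mul]
  mul_mem' := by
    rintro M N ⟨u, hu⟩ ⟨w, hw⟩
    refine ⟨M w, fun v x => ?_⟩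
    rw [CB.mul_apply, hu, hw, hu, mul_assoc]
  smul_mem' := by
    rintro c M ⟨u, hu⟩
    refine ⟨c • u, fun v x => ?_⟩
    rw [CB.coe_smul, map_smul, map_smul, Pi.smul_apply, Pi.smul_apply, hu, smul_mul_assoc]

variable (G) in
/-- The algebra `A_cb(G)`: the closure of `A(G)` in `CB(A(G))`, where functions act on `A(G)` by
multiplication; thus it is the closure of `A(G)` in the algebra of completely bounded multipliers. -/
def Acb : Type _ := (multiplicationOperators G).topologicalClosure

namespace Acb

instance : NonUnitalNormedRing (Acb G) :=
  inferInstanceAs (NonUnitalNormedRing (multiplicationOperators G).topologicalClosure)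

instance : NormedSpace ℂ (Acb G) :=
  inferInstanceAs (NormedSpace ℂ (multiplicationOperators G).topologicalClosure.toSubmodule)

instance : OperatorSpace (Acb G) :=
  inferInstanceAs (OperatorSpace (multiplicationOperators G).topologicalClosure.toSubmodule)

instance : CompleteSpace (Acb G) :=
  (NonUnitalSubalgebra.isClosed_topologicalClosure _).completeSpace_coe

/-- The operator on `A(G)` underlying an element of `A_cb(G)`. -/
def op (a : Acb G) : CB (FourierAlgebra G) (FourierAlgebra G) := Subtype.val a

instance : IsScalarTower ℂ (Acb G) (Acb G) :=
  inferInstanceAs (IsScalarTower ℂ (multiplicationOperators G).topologicalClosure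
    (multiplicationOperators G).topologicalClosure)

instance : SMulCommClass ℂ (Acb G) (Acb G) :=
  inferInstanceAs (SMulCommClass ℂ (multiplicationOperators G).topologicalClosure
    (multiplicationOperators G).topologicalClosure)

open Classical in
/-- The elements of `A_cb(G)` as functions on `G`. The function `a` is the one with
`op a v = a v` for all `v` in `A(G)`, so `a(x)` is the value at `x` of `op a δ_x`. -/
def toFun (a : Acb G) (x : G) : ℂ :=
  a.op (FourierAlgebra.coeff (lp.single 2 1 1) (lp.single 2 x 1)) x

instance : CoeFun (Acb G) fun _ => G → ℂ := ⟨toFun⟩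

/-- The operator `a` is the multiplication by the function `a`. -/
lemma op_apply (a : Acb G) (v : FourierAlgebra G) (x : G) : a.op v x = a x * v x := by
  classical
  set d : FourierAlgebra G := FourierAlgebra.coeff (lp.single 2 1 1) (lp.single 2 x 1) with hd
  have hdx : d x = 1 := by
    rw [hd, FourierAlgebra.coeff_apply, lp.inner_single_left]
    change inner ℂ (1 : ℂ) ((lp.single 2 (1 : G) (1 : ℂ) : EllTwo G) (x⁻¹ * x)) = 1
    rw [inv_mul_cancel, lp.single_apply_self]
    simp
  have hax : a x = a.op d x := by
    rw [hd]
    unfold toFun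
    congr!
  rw [hax]
  have hc : ∀ w : FourierAlgebra G,
      Continuous fun M : CB (FourierAlgebra G) (FourierAlgebra G) => M w x := fun w => by
    refine (FourierAlgebra.continuous_apply x).comp ?_
    let ev : CB (FourierAlgebra G) (FourierAlgebra G) →ₗ[ℂ] FourierAlgebra G :=
      { toFun := fun M => M w, map_add' := fun _ _ => rfl, map_smul' := fun _ _ => rfl }
    exact (ev.mkContinuous ‖w‖ fun M => by
      rw [mul_comm]; exact CB.norm_apply_le M w).continuous
  have hcl : IsClosed {M : CB (FourierAlgebra G) (FourierAlgebra G) | M v x = M d x * v x} :=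
    isClosed_eq (hc v) ((hc d).mul continuous_const)
  refine closure_minimal ?_ hcl (Subtype.property a)
  rintro M ⟨u, hu⟩
  change M v x = M d x * v x
  rw [hu, hu, hdx, mul_one]

end Acb

/-! ### The operator space `ℓ¹(G)` -/

section ellOne

variable {G : Type*}

/-- Pairs of a natural number `n` and an element of the unit ball of `M_n(ℓ^∞(G)) = ℓ^∞(G, M_n)`. -/
abbrev EllInftyBall (G : Type*) :=
  Σ n : ℕ, {T : G → Matrix (Fin n) (Fin n) ℂ // ∀ s, ‖T s‖ ≤ 1}

lemma ellOne_hasSum (f : EllOne G) : HasSum (fun s => ‖f s‖) ‖f‖ := by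
  have h := lp.hasSum_norm (p := 1) (by simp) f
  simpa using h

lemma ellOne_summable (t : EllInftyBall G) (f : EllOne G) : Summable fun s => f s • t.2.1 s := by
  refine Summable.of_norm_bounded (ellOne_hasSum f).summable fun s => ?_
  rw [norm_smul]
  exact mul_le_of_le_one_right (norm_nonneg _) (t.2.2 s)

/-- The pairing of `ℓ¹(G)` with a matrix `T` over `ℓ^∞(G)`: the matrix `∑ f(s) T(s)`. -/
def ellOneTest (t : EllInftyBall G) : EllOne G →ₗ[ℂ] Matrix (Fin t.1) (Fin t.1) ℂ where
  toFun f := ∑' s, f s • t.2.1 s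
  map_add' f g := by
    rw [← (ellOne_summable t f).tsum_add (ellOne_summable t g)]
    exact tsum_congr fun s => add_smul _ _ _
  map_smul' c f := by
    rw [RingHom.id_apply, ← (ellOne_summable t f).tsum_const_smul c]
    exact tsum_congr fun s => mul_smul _ _ _

lemma ellOneTest_le (t : EllInftyBall G) (f : EllOne G) : mnorm (ellOneTest t f) ≤ ‖f‖ := by
  rw [mnorm_complex]
  refine tsum_of_norm_bounded (ellOne_hasSum f) fun s => ?_
  rw [norm_smul]
  exact mul_le_of_le_one_right (norm_nonneg _) (t.2.2 s)

lemma ellOneTest_bdd (f : EllOne G) :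
    BddAbove (Set.range fun t : EllInftyBall G => mnorm (ellOneTest t f)) :=
  ⟨‖f‖, by rintro _ ⟨t, rfl⟩; exact ellOneTest_le t f⟩

instance : Nonempty (EllInftyBall G) := ⟨⟨0, 0, fun s => by simp⟩⟩

lemma ellOne_norm (f : EllOne G) : ‖f‖ = ⨆ t : EllInftyBall G, mnorm (ellOneTest t f) := by
  refine le_antisymm ?_ (ciSup_le fun t => ellOneTest_le t f)
  let c : G → ℂ := fun s => (starRingEnd ℂ) (f s) / ‖f s‖
  have hc : ∀ s, ‖c s‖ ≤ 1 := fun s => by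
    simp only [c, norm_div, RCLike.norm_conj, Complex.norm_real, norm_norm]
    exact div_self_le_one _
  let t : EllInftyBall G := ⟨1, fun s => Matrix.of fun _ _ => c s, fun s =>
    l2_le _ zero_le_one fun x => by
      simp only [Finset.univ_unique, Finset.sum_singleton, Matrix.of_apply, norm_mul, mul_pow]
      exact mul_le_mul_of_nonneg_right (pow_le_pow_left₀ (norm_nonneg _) (hc s) 2) (by positivity)⟩
  refine le_trans ?_ (le_ciSup (ellOneTest_bdd f) t)
  refine le_trans (le_of_eq ?_) (norm_entry_le (ellOneTest t f) (0 : Fin 1) (0 : Fin 1))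
  have h1 : HasSum (fun s => (f s • t.2.1 s)) (ellOneTest t f) := (ellOne_summable t f).hasSum
  have h2 : HasSum (fun s => f s * c s) (ellOneTest t f (0 : Fin 1) (0 : Fin 1)) :=
    Pi.hasSum.1 (Pi.hasSum.1 h1 (0 : Fin 1)) (0 : Fin 1)
  have h3 : HasSum (fun s => ((‖f s‖ : ℝ) : ℂ)) ((‖f‖ : ℝ) : ℂ) :=
    (Complex.hasSum_ofReal).2 (ellOne_hasSum f)
  have h4 : ∀ s, f s * c s = ((‖f s‖ : ℝ) : ℂ) := fun s => by
    simp only [c]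
    rw [mul_div_assoc', Complex.mul_conj, Complex.normSq_eq_norm_sq]
    by_cases h : ‖f s‖ = 0
    · simp [h]
    · push_cast
      field_simp
  simp only [h4] at h2
  rw [h2.unique h3, Complex.norm_real, norm_norm]

/-- The operator space `ℓ¹(G)`, as the predual of the commutative von Neumann algebra `ℓ^∞(G)`:
`‖[f_ij]‖` is the supremum of `‖[∑_s f_ij(s) T_kl(s)]‖` over all `n` and all `T` in the unit ball of
`M_n(ℓ^∞(G))`. -/
instance : OperatorSpace (EllOne G) :=
  OperatorSpace.ofTests (T := EllInftyBall G) (fun t => Fin t.1) ellOneTest ellOneTest_bdd ellOne_norm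

end ellOne

end group

end

universe u v

/-!
The operator space `ℓ¹(G)` has the largest possible matrix norms: a bounded family of vectors
indexed by `G` defines a completely bounded map on `ℓ¹(G)`. For families `v_s ⊗ w_s` of elementary
tensors in a projective tensor product this is immediate, because `V ⊗̂ W` carries the norms of
the duality with `CB(V, W*)`, and a matrix over `CB(V, W*)` evaluated at the family is a bounded
matrix-valued function on `G`, one of the functions `ℓ¹(G)` is tested against
(`EllOne.exists_cb_tmul`). Since `A(G)` is normed by `VN(G)` and evaluation at `s` is completely
contractive on it, multiplication by `δ_s` on `A(G)`, the rank one map `u ↦ u(s) δ_s`, is a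
complete contraction, so `δ_s` lies in the unit ball of `A_cb(G)` (`Acb.delta`).

Both assertions about `ℓ¹(G)` follow. The splitting map is the one attached to the family `δ_s ⊗
δ_s`. For projectivity, the open mapping theorem gives a bounded family of preimages `e_s` of
`S(δ_s)`; the family `δ_s ⊗ e_s` defines a completely bounded map from `ℓ¹(G)` to `A_cb(G) ⊗̂ E`,
and its composition with the action `A_cb(G) ⊗̂ E → E` is the lift `δ_s ↦ δ_s · e_s`. It is a
module map, as is the splitting map, because `a δ_s = a(s) δ_s`.

The module structures and the multiplication of `A_cb(G)` come from the universal property of the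
projective tensor product (`ProjTensor.exists_lift`). It is proved for targets whose matrix norms
are detected by matrices of functionals (`IsDualNormed`); this avoids Ruan's theorem, and passes
to subspaces and to spaces `CB(V, W)`. The one target where it is not formal is `A_cb(G)`, whose
norms come from those of `A(G)`, defined as a quotient of the predual of `VN(G)`. There one has to
know that the quotient is trivial, that is, that a normal functional on `VN(G)` which vanishes on
all `λ(x)` vanishes (`ker_predualToFun`). Every bounded functional on the predual is the
evaluation at an element of `VN(G)`, so by the Hahn-Banach theorem and successive approximation
every normal functional is an absolutely convergent sum of vector functionals; it is then a vector
functional of an amplification of `VN(G)`, and the argument of the bicommutant theorem applies.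
-/

noncomputable section

open OperatorSpace TensorProduct

/-! ### Matrix norms and completely bounded maps -/

section general

variable {V W X : Type*} [NormedAddCommGroup V] [NormedSpace ℂ V] [OperatorSpace V]
  [NormedAddCommGroup W] [NormedSpace ℂ W] [OperatorSpace W]
  [NormedAddCommGroup X] [NormedSpace ℂ X] [OperatorSpace X]
  {ι κ : Type} [Fintype ι] [Fintype κ]

namespace OperatorSpace

lemma mnorm_const_of_unique [Unique ι] (v : V) : mnorm (Matrix.of fun _ _ : ι => v) = ‖v‖ := by
  rw [← mnorm_one_by_one, ← mnorm_reindex (Equiv.ofUnique Unit ι)]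
  rfl

lemma mnorm_neg_le (x : Matrix ι ι V) : mnorm (-x) ≤ mnorm x := by
  simpa using mnorm_smul_le (-1) x

lemma continuous_mnorm : Continuous fun x : Matrix ι ι V => mnorm x := by
  refine continuous_iff_continuousAt.2 fun x => ?_
  have hlim : Filter.Tendsto (fun y : Matrix ι ι V => ∑ i, ∑ j, ‖y i j - x i j‖) (nhds x)
      (nhds 0) := by
    have : Continuous fun y : Matrix ι ι V => ∑ i, ∑ j, ‖y i j - x i j‖ := by fun_prop
    simpa using this.tendsto x
  refine tendsto_iff_dist_tendsto_zero.2 (squeeze_zero (fun _ => dist_nonneg) (fun y => ?_) hlim)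
  have h1 : mnorm (y - x) ≤ ∑ i, ∑ j, ‖y i j - x i j‖ := mnorm_le_sum _
  have h2 := mnorm_add_le (y - x) x
  have h3 := mnorm_add_le (-(y - x)) y
  have h4 := mnorm_neg_le (y - x)
  rw [sub_add_cancel] at h2
  rw [neg_sub, sub_add_cancel] at h3
  rw [neg_sub] at h4
  rw [Real.dist_eq, abs_le]
  constructor <;> linarith

end OperatorSpace

namespace CB

lemma norm_mk_le (φ : V →ₗ[ℂ] W) {C : ℝ} (hC : 0 ≤ C)
    (h : ∀ (n : ℕ) (x : Matrix (Fin n) (Fin n) V), mnorm (x.map φ) ≤ C * mnorm x) :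
    ‖mk φ C h‖ ≤ C :=
  cbNorm_le _ hC h

lemma mnorm_map_le (φ : CB V W) (x : Matrix κ κ V) : mnorm (x.map φ) ≤ ‖φ‖ * mnorm x := by
  have h := le_cbNorm φ (x.submatrix (Fintype.equivFin κ).symm (Fintype.equivFin κ).symm)
  rw [mnorm_reindex] at h
  rw [← mnorm_reindex (Fintype.equivFin κ).symm (x.map φ)]
  exact h

/-- The bounded linear map underlying a completely bounded map. -/
def toCLM (φ : CB V W) : V →L[ℂ] W := φ.toLin.mkContinuous ‖φ‖ φ.norm_apply_le

protected lemma continuous (φ : CB V W) : Continuous φ := φ.toCLM.continuous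

/-- The matrix `[Φ_ij(x_kl)]` obtained by applying a matrix of completely bounded maps to a matrix
of vectors. -/
def pair (Φ : Matrix ι ι (CB V W)) (x : Matrix κ κ V) : Matrix (ι × κ) (ι × κ) W :=
  Matrix.of fun p q => Φ p.1 q.1 (x p.2 q.2)

lemma mnorm_pair_le (Φ : Matrix ι ι (CB V W)) (x : Matrix κ κ V) :
    mnorm (pair Φ x) ≤ mnorm Φ * mnorm x := by
  have h1 : ∀ (n : ℕ) (x : Matrix (Fin n) (Fin n) V), mnorm x ≤ 1 → mnorm (pair Φ x) ≤ mnorm Φ :=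
    fun n x hx => le_ciSup
      (testMatrix_bdd (fun t : Ball V => Fin t.1) (test (V := V) (W := W)) test_bdd Φ) ⟨n, x, hx⟩
  have h2 : ∀ (n : ℕ) (x : Matrix (Fin n) (Fin n) V) (r : ℝ), mnorm x < r →
      mnorm (pair Φ x) ≤ mnorm Φ * r := fun n x r hr => by
    have hr0 : 0 < r := (mnorm_nonneg x).trans_lt hr
    have hx : mnorm (((r⁻¹ : ℝ) : ℂ) • x) ≤ 1 := by
      refine (mnorm_smul_le _ _).trans ?_
      rw [Complex.norm_real, Real.norm_of_nonneg (by positivity), inv_mul_le_one₀ hr0]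
      exact hr.le
    have e : pair Φ x = ((r : ℝ) : ℂ) • pair Φ (((r⁻¹ : ℝ) : ℂ) • x) := by
      ext p q
      simp only [pair, Matrix.of_apply, Matrix.smul_apply, map_smul, smul_smul]
      rw [← Complex.ofReal_mul, mul_inv_cancel₀ hr0.ne']
      simp
    rw [e, mul_comm]
    refine (mnorm_smul_le _ _).trans ?_
    rw [Complex.norm_real, Real.norm_of_nonneg hr0.le]
    exact mul_le_mul_of_nonneg_left (h1 n _ hx) hr0.le
  have h3 : ∀ (n : ℕ) (x : Matrix (Fin n) (Fin n) V),
      mnorm (pair Φ x) ≤ mnorm Φ * mnorm x := fun n x => by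
    have hlim : Filter.Tendsto (fun r => mnorm Φ * r) (nhdsWithin (mnorm x) (Set.Ioi (mnorm x)))
        (nhds (mnorm Φ * mnorm x)) :=
      (Continuous.tendsto (by fun_prop) _).mono_left nhdsWithin_le_nhds
    refine ge_of_tendsto hlim ?_
    filter_upwards [self_mem_nhdsWithin] with r hr
    exact h2 n x r hr
  have h := h3 _ (x.submatrix (Fintype.equivFin κ).symm (Fintype.equivFin κ).symm)
  rw [mnorm_reindex] at h
  refine le_trans (le_of_eq ?_) h
  rw [← mnorm_reindex ((Equiv.refl ι).prodCongr (Fintype.equivFin κ).symm) (pair Φ x)]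
  rfl

lemma mnorm_le (Φ : Matrix ι ι (CB V W)) {C : ℝ} (hC : 0 ≤ C)
    (h : ∀ (n : ℕ) (x : Matrix (Fin n) (Fin n) V), mnorm (pair Φ x) ≤ C * mnorm x) :
    mnorm Φ ≤ C :=
  ciSup_le fun t => (h t.1 t.2.1).trans (mul_le_of_le_one_right hC t.2.2)

/-- Composition of completely bounded maps. -/
def comp (φ : CB W X) (ψ : CB V W) : CB V X :=
  mk (φ.toLin ∘ₗ ψ.toLin) (‖φ‖ * ‖ψ‖) fun _ x => by
    rw [mul_assoc]
    exact (mnorm_map_le φ (x.map ψ)).trans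
      (mul_le_mul_of_nonneg_left (mnorm_map_le ψ x) (norm_nonneg φ))

lemma comp_apply (φ : CB W X) (ψ : CB V W) (v : V) : comp φ ψ v = φ (ψ v) := rfl

/-- Evaluation at a vector, as a completely bounded map on `CB(V, W)`. -/
def eval (v : V) : CB (CB V W) W :=
  mk { toFun := fun φ => φ v, map_add' := fun _ _ => rfl, map_smul' := fun _ _ => rfl } ‖v‖
    fun _ Φ => by rw [mul_comm]; exact mnorm_map_apply_le Φ v

/-- Completely bounded maps are determined by their values on the range of a map with dense
range. -/
lemma ext_of_denseRange {U : Type*} {e : U → V} (he : DenseRange e) {φ ψ : CB V W}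
    (h : ∀ u, φ (e u) = ψ (e u)) : φ = ψ :=
  ext (congrFun (he.equalizer φ.continuous ψ.continuous (funext h)))

/-- A linear map given on a dense subspace extends to a completely bounded map if it is bounded
uniformly on matrices over that subspace. -/
lemma exists_extension {U : Type*} [AddCommGroup U] [Module ℂ U] [CompleteSpace W]
    (e : U →ₗ[ℂ] V) (f : U →ₗ[ℂ] W) (he : DenseRange e) {C : ℝ} (hC : 0 ≤ C)
    (h : ∀ (n : ℕ) (x : Matrix (Fin n) (Fin n) U), mnorm (x.map f) ≤ C * mnorm (x.map e)) :
    ∃ L : CB V W, ‖L‖ ≤ C ∧ ∀ u, L (e u) = f u := by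
  have h1 : ∀ u, ‖f u‖ ≤ C * ‖e u‖ := fun u => by
    have := h 1 (Matrix.of fun _ _ => u)
    rw [← mnorm_const_of_unique (ι := Fin 1) (f u), ← mnorm_const_of_unique (ι := Fin 1) (e u)]
    exact this
  set L := f.extendOfNorm e with hL
  have hLe : ∀ u, L (e u) = f u := LinearMap.extendOfNorm_eq he ⟨C, h1⟩
  have key : ∀ (n : ℕ) (x : Matrix (Fin n) (Fin n) V), mnorm (x.map L) ≤ C * mnorm x := by
    intro n
    have hd : DenseRange fun x : Matrix (Fin n) (Fin n) U => x.map e :=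
      DenseRange.piMap fun _ => DenseRange.piMap fun _ => he
    have hcl : IsClosed {x : Matrix (Fin n) (Fin n) V | mnorm (x.map L) ≤ C * mnorm x} :=
      isClosed_le (continuous_mnorm.comp (continuous_id.matrix_map L.continuous))
        (continuous_const.mul continuous_mnorm)
    refine fun x => hd.induction_on (p := fun x => mnorm (x.map L) ≤ C * mnorm x) x hcl fun u => ?_
    have e1 : (u.map e).map L = u.map f := by ext i j; exact hLe _
    rw [e1]
    exact h n u
  exact ⟨mk L.toLinearMap C key, norm_mk_le _ hC key, hLe⟩

end CB

end general

/-! ### Maps out of the projective tensor product -/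

section lift

variable {V W Z : Type*} [NormedAddCommGroup V] [NormedSpace ℂ V] [OperatorSpace V]
  [NormedAddCommGroup W] [NormedSpace ℂ W] [OperatorSpace W]
  [NormedAddCommGroup Z] [NormedSpace ℂ Z] [OperatorSpace Z]

/-- The matrix norms of `Z` are determined by matrices of functionals: `‖z‖ ≤ C` as soon as
`‖[ψ_kl(z_ij)]‖ ≤ C` for all matrices `ψ` in the unit balls of the matrix spaces over `Z*`. (Every
operator space has this property, by Ruan's theorem; for the spaces needed here it is elementary,
since their norms are defined by duality.) -/
def IsDualNormed (Z : Type*) [NormedAddCommGroup Z] [NormedSpace ℂ Z] [OperatorSpace Z] : Prop :=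
  ∀ (ι : Type) [Fintype ι] (z : Matrix ι ι Z) (C : ℝ), 0 ≤ C →
    (∀ (κ : Type) [Fintype κ] (ψ : Matrix κ κ (OpDual Z)), mnorm ψ ≤ 1 →
      mnorm (CB.pair ψ z) ≤ C) → mnorm z ≤ C

namespace IsDualNormed

lemma complex : IsDualNormed ℂ := by
  intro ι _ z C hC h
  let φ : OpDual ℂ := CB.mk LinearMap.id 1 fun n x => by
    rw [one_mul]
    exact le_of_eq rfl
  have hφ : mnorm (Matrix.of fun _ _ : Unit => φ) ≤ 1 := by
    rw [mnorm_one_by_one]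
    exact CB.norm_mk_le _ zero_le_one _
  refine le_trans (le_of_eq ?_) (h Unit (Matrix.of fun _ _ => φ) hφ)
  rw [← mnorm_reindex (Equiv.punitProd.{0, 0} ι) z]
  rfl

/-- The property passes to any space that embeds completely isometrically. -/
lemma of_isometry (hZ : IsDualNormed Z) (J : V →ₗ[ℂ] Z)
    (hJ : ∀ (ι : Type) [Fintype ι] (x : Matrix ι ι V), mnorm (x.map J) = mnorm x) :
    IsDualNormed V := by
  intro ι _ x C hC h
  rw [← hJ]
  refine hZ ι _ C hC fun κ _ ψ hψ => ?_
  let J' : CB V Z := CB.mk J 1 fun n x => by rw [hJ, one_mul]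
  refine h κ (ψ.map fun φ => CB.comp φ J') (CB.mnorm_le _ zero_le_one fun n y => ?_)
  refine (CB.mnorm_pair_le ψ (y.map J)).trans ?_
  rw [hJ]
  exact mul_le_mul_of_nonneg_right hψ (mnorm_nonneg y)

lemma submodule (hZ : IsDualNormed Z) (S : Submodule ℂ Z) : IsDualNormed S :=
  hZ.of_isometry S.subtype fun _ _ _ => rfl

lemma cb (hW : IsDualNormed W) : IsDualNormed (CB V W) := by
  intro ι _ Φ C hC h
  refine ciSup_le fun t => ?_
  obtain ⟨n, x, hx⟩ := t
  refine hW (ι × Fin n) (CB.pair Φ x) C hC fun κ _ ψ hψ => ?_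
  -- the functionals `φ ↦ ψ_kl(φ(x_pq))` form a matrix in the unit ball
  let ψ' : Matrix (κ × Fin n) (κ × Fin n) (OpDual (CB V W)) :=
    Matrix.of fun p q => CB.comp (ψ p.1 q.1) (CB.eval (x p.2 q.2))
  have hψ' : mnorm ψ' ≤ 1 := CB.mnorm_le _ zero_le_one fun r Ψ => by
    have e : CB.pair ψ' Ψ = (CB.pair ψ (CB.pair Ψ x)).submatrix
        ((Equiv.prodAssoc κ (Fin n) (Fin r)).trans
          ((Equiv.refl κ).prodCongr (Equiv.prodComm (Fin n) (Fin r))))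
        ((Equiv.prodAssoc κ (Fin n) (Fin r)).trans
          ((Equiv.refl κ).prodCongr (Equiv.prodComm (Fin n) (Fin r)))) := rfl
    rw [e, mnorm_reindex]
    have h1 := CB.mnorm_pair_le ψ (CB.pair Ψ x)
    have h2 := CB.mnorm_pair_le Ψ x
    have := mnorm_nonneg Ψ
    have := mnorm_nonneg (CB.pair Ψ x)
    nlinarith [mnorm_nonneg ψ, mnorm_nonneg x]
  refine le_trans (le_of_eq ?_) (h _ ψ' hψ')
  rw [← mnorm_reindex ((Equiv.prodAssoc κ (Fin n) ι).trans
    ((Equiv.refl κ).prodCongr (Equiv.prodComm (Fin n) ι)))]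
  rfl

lemma opDual : IsDualNormed (OpDual V) := complex.cb

end IsDualNormed

namespace ProjTensor

/-- The functional on `CB(V, W*)` underlying an element of `V ⊗̂ W`. -/
def functional (x : ProjTensor V W) : OpDual (CB V (OpDual W)) := Subtype.val x

lemma isDualNormed : IsDualNormed (ProjTensor V W) :=
  IsDualNormed.opDual.submodule (tensorSubspace V W)

/-- The norm on matrices over `V ⊗̂ W` is the one of the duality with `CB(V, W*)`. -/
lemma mnorm_le {ι : Type} [Fintype ι] (x : Matrix ι ι (ProjTensor V W)) {C : ℝ} (hC : 0 ≤ C)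
    (h : ∀ (n : ℕ) (Φ : Matrix (Fin n) (Fin n) (CB V (OpDual W))),
      mnorm (CB.pair (x.map functional) Φ) ≤ C * mnorm Φ) : mnorm x ≤ C :=
  CB.mnorm_le (x.map functional) hC h

lemma mnorm_pair_le {ι κ : Type} [Fintype ι] [Fintype κ] (x : Matrix ι ι (ProjTensor V W))
    (Φ : Matrix κ κ (CB V (OpDual W))) :
    mnorm (CB.pair (x.map functional) Φ) ≤ mnorm x * mnorm Φ :=
  CB.mnorm_pair_le (x.map functional) Φ

lemma norm_tmul_le (v : V) (w : W) : ‖tmul v w‖ ≤ ‖v‖ * ‖w‖ :=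
  show ‖elementaryTensor v w‖ ≤ _ by
    unfold elementaryTensor
    exact CB.norm_mk_le _ (by positivity) _

variable (V W) in
/-- The elementary tensor as a bilinear map. -/
def tmulₗ : V →ₗ[ℂ] W →ₗ[ℂ] ProjTensor V W :=
  LinearMap.mk₂ ℂ tmul
    (fun _ _ _ => Subtype.ext (CB.ext fun Φ =>
      congrArg (fun φ : OpDual W => φ _) (map_add Φ.toLin _ _)))
    (fun _ _ _ => Subtype.ext (CB.ext fun Φ =>
      congrArg (fun φ : OpDual W => φ _) (map_smul Φ.toLin _ _)))
    (fun _ _ _ => Subtype.ext (CB.ext fun Φ => map_add (Φ _).toLin _ _))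
    (fun _ _ _ => Subtype.ext (CB.ext fun Φ => map_smul (Φ _).toLin _ _))

lemma denseRange_lift_tmulₗ : DenseRange (TensorProduct.lift (tmulₗ V W)) := by
  intro x
  refine (closure_subtype (x := x)).2 ?_
  have h : ((x : ProjTensor V W).functional : OpDual (CB V (OpDual W))) ∈
      closure ((Submodule.span ℂ (Set.range fun p : V × W => elementaryTensor p.1 p.2) :
        Submodule ℂ (OpDual (CB V (OpDual W)))) : Set (OpDual (CB V (OpDual W)))) := x.2
  refine closure_mono ?_ h
  have : Submodule.span ℂ (Set.range fun p : V × W => elementaryTensor p.1 p.2) ≤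
      LinearMap.range ((tensorSubspace V W).subtype ∘ₗ TensorProduct.lift (tmulₗ V W)) := by
    rw [Submodule.span_le]
    rintro _ ⟨⟨v, w⟩, rfl⟩
    exact ⟨v ⊗ₜ[ℂ] w, rfl⟩
  intro φ hφ
  obtain ⟨u, hu⟩ := this hφ
  exact ⟨_, ⟨u, rfl⟩, hu⟩

/-- Completely bounded maps on `V ⊗̂ W` which agree on elementary tensors are equal. -/
lemma cb_ext {φ ψ : CB (ProjTensor V W) Z} (h : ∀ v w, φ (tmul v w) = ψ (tmul v w)) : φ = ψ := by
  refine CB.ext_of_denseRange denseRange_lift_tmulₗ fun u => ?_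
  have : φ.toLin ∘ₗ TensorProduct.lift (tmulₗ V W) = ψ.toLin ∘ₗ TensorProduct.lift (tmulₗ V W) :=
    TensorProduct.ext' h
  exact LinearMap.congr_fun this u

/-- The bilinear map `b` is jointly completely bounded with constant `C`. -/
def _root_.IsJointlyCB (b : V →ₗ[ℂ] W →ₗ[ℂ] Z) (C : ℝ) : Prop :=
  ∀ (ι κ : Type) [Fintype ι] [Fintype κ] (v : Matrix ι ι V) (w : Matrix κ κ W),
    mnorm (Matrix.of fun p q : ι × κ => b (v p.1 q.1) (w p.2 q.2)) ≤ C * mnorm v * mnorm w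

/-- The universal property of `V ⊗̂ W`: a jointly completely bounded bilinear map extends to a
completely bounded map on `V ⊗̂ W`. A matrix of functionals on the target turns the bilinear map into
a matrix over `CB(V, W*)`, which is what elements of `V ⊗̂ W` are tested against. -/
lemma exists_lift [CompleteSpace Z] (hZ : IsDualNormed Z) (b : V →ₗ[ℂ] W →ₗ[ℂ] Z) {C : ℝ}
    (hC : 0 ≤ C) (hb : IsJointlyCB b C) :
    ∃ L : CB (ProjTensor V W) Z, ‖L‖ ≤ C ∧ ∀ v w, L (tmul v w) = b v w := by
  suffices H : ∀ (n : ℕ) (x : Matrix (Fin n) (Fin n) (V ⊗[ℂ] W)),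
      mnorm (x.map (TensorProduct.lift b)) ≤
        C * mnorm (x.map (TensorProduct.lift (tmulₗ V W))) by
    obtain ⟨L, hL, hLe⟩ := CB.exists_extension (TensorProduct.lift (tmulₗ V W))
      (TensorProduct.lift b) denseRange_lift_tmulₗ hC H
    exact ⟨L, hL, fun v w => hLe (v ⊗ₜ[ℂ] w)⟩
  intro n x
  refine hZ _ _ _ (mul_nonneg hC (mnorm_nonneg _)) fun κ _ ψ hψ => ?_
  have hpos : ∀ {τ : Type} [Fintype τ] (v : Matrix τ τ V), 0 ≤ C * mnorm v :=
    fun v => mul_nonneg hC (mnorm_nonneg v)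
  -- the bilinear map `b`, curried
  let b₁ : V → CB W Z := fun v => CB.mk (b v) (C * ‖v‖) fun m w => by
    have := hb Unit (Fin m) (Matrix.of fun _ _ => v) w
    rw [mnorm_one_by_one] at this
    refine le_trans (le_of_eq ?_) this
    rw [← mnorm_reindex (Equiv.punitProd.{0, 0} (Fin m))]
    rfl
  let Ψ : κ → κ → V →ₗ[ℂ] OpDual W := fun k l =>
    { toFun := fun v => CB.comp (ψ k l) (b₁ v)
      map_add' := fun v v' => CB.ext fun w => by
        change ψ k l (b (v + v') w) = ψ k l (b v w) + ψ k l (b v' w)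
        rw [map_add, LinearMap.add_apply, map_add]
      map_smul' := fun c v => CB.ext fun w => by
        change ψ k l (b (c • v) w) = c • ψ k l (b v w)
        rw [map_smul, LinearMap.smul_apply, map_smul] }
  let Φ : Matrix κ κ (CB V (OpDual W)) := Matrix.of fun k l =>
    CB.mk (Ψ k l) (‖ψ k l‖ * C) fun m v => by
      have h0 : 0 ≤ ‖ψ k l‖ * C := mul_nonneg (norm_nonneg _) hC
      refine CB.mnorm_le _ (mul_nonneg h0 (mnorm_nonneg v)) fun r w => ?_
      refine (CB.mnorm_map_le (ψ k l)
        (Matrix.of fun p q : Fin m × Fin r => b (v p.1 q.1) (w p.2 q.2))).trans ?_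
      refine (mul_le_mul_of_nonneg_left (hb _ _ v w) (norm_nonneg _)).trans (le_of_eq ?_)
      ring
  have hΦ : mnorm Φ ≤ C := CB.mnorm_le _ hC fun m v => by
    refine CB.mnorm_le _ (hpos v) fun r w => ?_
    have h1 := CB.mnorm_pair_le ψ
      (Matrix.of fun p q : Fin m × Fin r => b (v p.1 q.1) (w p.2 q.2))
    have h2 := hb _ _ v w
    refine le_trans (le_of_eq ?_) (h1.trans ((mul_le_mul hψ h2 (mnorm_nonneg _) zero_le_one).trans
      (one_mul _).le))
    rw [← mnorm_reindex (Equiv.prodAssoc κ (Fin m) (Fin r))]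
    rfl
  have hval : ∀ k l u, (TensorProduct.lift (tmulₗ V W) u).functional (Φ k l) =
      ψ k l (TensorProduct.lift b u) := fun k l u => by
    let ev : ProjTensor V W →ₗ[ℂ] ℂ :=
      { toFun := fun y => y.functional (Φ k l), map_add' := fun _ _ => rfl, map_smul' := fun _ _ => rfl }
    have : ev ∘ₗ TensorProduct.lift (tmulₗ V W) = (ψ k l).toLin ∘ₗ TensorProduct.lift b :=
      TensorProduct.ext' fun v w => rfl
    exact LinearMap.congr_fun this u
  have h1 := mnorm_pair_le (x.map (TensorProduct.lift (tmulₗ V W))) Φ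
  have e : CB.pair ψ (x.map (TensorProduct.lift b)) =
      (CB.pair ((x.map (TensorProduct.lift (tmulₗ V W))).map functional) Φ).submatrix
        (Equiv.prodComm κ (Fin n)) (Equiv.prodComm κ (Fin n)) := by
    ext p q
    exact (hval p.1 q.1 (x p.2 q.2)).symm
  rw [e, mnorm_reindex, mul_comm C]
  exact h1.trans (mul_le_mul_of_nonneg_left hΦ (mnorm_nonneg _))

end ProjTensor

end lift

/-! ### Atomic decompositions in a Banach space -/

section atomic

variable {V I : Type*} [NormedAddCommGroup V] [NormedSpace ℂ V] [CompleteSpace V]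

/-- A norming family of vectors of the unit ball spans the space in the `ℓ¹` sense: by the
Hahn-Banach theorem the closure of the image of the unit ball of `ℓ¹(I)` is the unit ball, and
successive approximation, as in the open mapping theorem, removes the closure. -/
lemma exists_hasSum_of_norming (ω : I → V) (hω : ∀ i, ‖ω i‖ ≤ 1)
    (h : ∀ F : V →L[ℂ] ℂ, (∀ i, ‖F (ω i)‖ ≤ 1) → ∀ v, ‖F v‖ ≤ ‖v‖) (v : V) :
    ∃ c : I → ℂ, (Summable fun i => ‖c i‖) ∧ HasSum (fun i => c i • ω i) v := by
  classical
  have hsum : ∀ c : lp (fun _ : I => ℂ) 1, HasSum (fun i => ‖c i‖) ‖c‖ := fun c => by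
    simpa using lp.hasSum_norm (p := 1) (by simp) c
  have hle : ∀ (c : lp (fun _ : I => ℂ) 1) i, ‖c i • ω i‖ ≤ ‖c i‖ := fun c i => by
    rw [norm_smul]
    exact mul_le_of_le_one_right (norm_nonneg _) (hω i)
  have hsumm : ∀ c : lp (fun _ : I => ℂ) 1, Summable fun i => c i • ω i := fun c =>
    Summable.of_norm_bounded (hsum c).summable (hle c)
  let Θ : lp (fun _ : I => ℂ) 1 →L[ℂ] V := LinearMap.mkContinuous
    { toFun := fun c => ∑' i, c i • ω i
      map_add' := fun c d => by
        rw [← (hsumm c).tsum_add (hsumm d)]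
        exact tsum_congr fun i => add_smul _ _ _
      map_smul' := fun a c => by
        rw [RingHom.id_apply, ← (hsumm c).tsum_const_smul a]
        exact tsum_congr fun i => mul_smul _ _ _ } 1 fun c => by
    rw [one_mul]
    exact tsum_of_norm_bounded (hsum c) (hle c)
  have hΘs : ∀ i a, Θ (lp.single 1 i a) = a • ω i := fun i a => by
    refine (tsum_eq_single i fun j hj => ?_).trans ?_
    · rw [lp.single_apply_ne _ _ _ hj, zero_smul]
    · rw [lp.single_apply_self]
  -- the unit ball is contained in the closure of the image of the unit ball
  have step1 : ∀ v : V, ‖v‖ ≤ 1 → v ∈ closure (Θ '' Metric.closedBall 0 1) := by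
    intro v hv
    by_contra hc
    have hconv : Convex ℝ (Θ '' Metric.closedBall 0 1) :=
      (convex_closedBall (0 : lp (fun _ : I => ℂ) 1) 1).is_linear_image (f := Θ)
        ⟨map_add Θ, fun c x => by
          have := map_smul Θ (c : ℂ) x
          exact this⟩
    obtain ⟨F, u, hF, hu⟩ := RCLike.geometric_hahn_banach_closed_point (𝕜 := ℂ) hconv.closure
      isClosed_closure hc
    have h0 : 0 < u := by
      have := hF 0 (subset_closure ⟨0, by simp, by simp⟩)
      simpa using this
    have hi : ∀ i, ‖F (ω i)‖ ≤ u := fun i => by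
      by_cases hz : F (ω i) = 0
      · rw [hz, norm_zero]
        exact h0.le
      have hz' : (‖F (ω i)‖ : ℂ) ≠ 0 := by simpa using hz
      have h1 := hF (Θ (lp.single 1 i ((starRingEnd ℂ) (F (ω i)) / ‖F (ω i)‖)))
        (subset_closure ⟨_, by
          rw [mem_closedBall_zero_iff, lp.norm_single (by simp)]
          simp [hz], rfl⟩)
      rw [hΘs, map_smul, smul_eq_mul, div_mul_eq_mul_div, mul_comm, Complex.mul_conj,
        Complex.normSq_eq_norm_sq] at h1
      have e : (((‖F (ω i)‖ ^ 2 : ℝ) : ℂ) / ‖F (ω i)‖) = ((‖F (ω i)‖ : ℝ) : ℂ) := by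
        push_cast
        field_simp
      rw [e] at h1
      have h2 : ‖F (ω i)‖ < u := by simpa using h1
      exact h2.le
    have h3 := h (((u⁻¹ : ℝ) : ℂ) • F) (fun i => by
      rw [_root_.smul_apply, norm_smul, Complex.norm_real, Real.norm_of_nonneg (by positivity),
        inv_mul_le_one₀ h0]
      exact hi i) v
    rw [_root_.smul_apply, norm_smul, Complex.norm_real, Real.norm_of_nonneg (by positivity),
      inv_mul_le_iff₀ h0] at h3
    have h4 : u < ‖F v‖ := hu.trans_le (Complex.re_le_norm _)
    nlinarith
  have step2 : ∀ v : V, ∃ c, ‖c‖ ≤ ‖v‖ ∧ ‖v - Θ c‖ ≤ ‖v‖ / 2 := by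
    intro v
    by_cases hv : v = 0
    · exact ⟨0, by simp, by simp [hv]⟩
    have hv' : 0 < ‖v‖ := norm_pos_iff.2 hv
    have h1 : ‖((‖v‖⁻¹ : ℝ) : ℂ) • v‖ ≤ 1 := by
      rw [norm_smul, Complex.norm_real, Real.norm_of_nonneg (by positivity),
        inv_mul_cancel₀ hv'.ne']
    obtain ⟨_, ⟨c, hc, rfl⟩, hd⟩ := Metric.mem_closure_iff.1 (step1 _ h1) (1 / 2) (by norm_num)
    refine ⟨((‖v‖ : ℝ) : ℂ) • c, ?_, ?_⟩
    · rw [norm_smul, Complex.norm_real, norm_norm]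
      exact mul_le_of_le_one_right (norm_nonneg _) (mem_closedBall_zero_iff.1 hc)
    · have e : v - Θ (((‖v‖ : ℝ) : ℂ) • c) =
          ((‖v‖ : ℝ) : ℂ) • (((‖v‖⁻¹ : ℝ) : ℂ) • v - Θ c) := by
        rw [map_smul, smul_sub, smul_smul, ← Complex.ofReal_mul, mul_inv_cancel₀ hv'.ne',
          Complex.ofReal_one, one_smul]
      rw [e, norm_smul, Complex.norm_real, norm_norm, ← dist_eq_norm]
      nlinarith
  choose g hg hg' using step2
  let r : ℕ → V := fun n => (fun w => w - Θ (g w))^[n] v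
  have hr : ∀ n, r (n + 1) = r n - Θ (g (r n)) := fun n => Function.iterate_succ_apply' _ _ _
  have hrn : ∀ n, ‖r n‖ ≤ ‖v‖ * (1 / 2) ^ n := by
    intro n
    induction n with
    | zero => simp [r]
    | succ n ih =>
      rw [hr, pow_succ]
      refine (hg' _).trans ?_
      linarith
  have hgeo : Summable fun n : ℕ => ‖v‖ * (1 / 2 : ℝ) ^ n :=
    (summable_geometric_of_lt_one (by norm_num) (by norm_num)).mul_left _
  have hs : Summable fun n => g (r n) :=
    Summable.of_norm_bounded hgeo fun n => (hg _).trans (hrn n)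
  have hr0 : Filter.Tendsto r Filter.atTop (nhds 0) :=
    squeeze_zero_norm hrn hgeo.tendsto_atTop_zero
  have hps : ∀ n, ∑ k ∈ Finset.range n, Θ (g (r k)) = v - r n := by
    intro n
    induction n with
    | zero => simp [r]
    | succ n ih =>
      rw [Finset.sum_range_succ, ih, hr]
      abel
  have hv : Θ (∑' n, g (r n)) = v := by
    have h1 := (hs.hasSum.mapL Θ).tendsto_sum_nat
    simp only [hps] at h1
    have h2 := (tendsto_const_nhds (x := v)).sub hr0
    rw [sub_zero] at h2
    exact tendsto_nhds_unique h1 h2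
  refine ⟨fun i => (∑' n, g (r n) : lp (fun _ : I => ℂ) 1) i, (hsum _).summable, ?_⟩
  have h1 := (hsumm (∑' n, g (r n))).hasSum
  have h2 : (∑' i, (∑' n, g (r n) : lp (fun _ : I => ℂ) 1) i • ω i) = v := hv
  rwa [h2] at h1

end atomic

/-! ### Ultraweakly continuous functionals and the bicommutant -/

section bicommutant

variable {H I : Type*} [NormedAddCommGroup H] [InnerProductSpace ℂ H]

/-- The amplification `T ⊗ 1` of an operator on `H` to the Hilbert space direct sum of copies
of `H`. -/
def amplification (I : Type*) (T : H →L[ℂ] H) :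
    lp (fun _ : I => H) 2 →L[ℂ] lp (fun _ : I => H) 2 :=
  LinearMap.mkContinuous
    { toFun := fun x => ⟨fun i => T (x i),
        ((lp.memℓp x).const_smul (‖T‖ : ℂ)).mono' fun i => by
          rw [Pi.smul_apply, norm_smul, Complex.norm_real, norm_norm]
          exact T.le_opNorm _⟩
      map_add' := fun x y => lp.ext (funext fun i => map_add T _ _)
      map_smul' := fun c x => lp.ext (funext fun i => map_smul T _ _) } ‖T‖ fun x => by
    have : ‖T‖ * ‖x‖ = ‖(‖T‖ : ℂ) • x‖ := by
      rw [norm_smul, Complex.norm_real, norm_norm]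
    rw [this]
    refine lp.norm_mono (by simp) fun i => ?_
    have h : ‖T (x i)‖ ≤ ‖(‖T‖ : ℂ) • x i‖ := by
      rw [norm_smul, Complex.norm_real, norm_norm]
      exact T.le_opNorm _
    exact h

lemma amplification_apply (T : H →L[ℂ] H) (x : lp (fun _ : I => H) 2) (i : I) :
    amplification I T x i = T (x i) := rfl

variable [CompleteSpace H]

/-- A vector functional of the amplification which vanishes on a self-adjoint monoid of operators
vanishes on its bicommutant: the projection onto the cyclic subspace generated by `ξ` commutes with
the monoid, so its matrix entries do, and therefore it commutes with the bicommutant. -/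
lemma inner_amplification_eq_zero (Λ : Submonoid (H →L[ℂ] H))
    (hΛ : ∀ A ∈ Λ, ContinuousLinearMap.adjoint A ∈ Λ) (T : H →L[ℂ] H)
    (hT : ∀ S : H →L[ℂ] H, (∀ A ∈ Λ, S * A = A * S) → S * T = T * S)
    (ξ η : lp (fun _ : I => H) 2) (h : ∀ A ∈ Λ, inner ℂ η (amplification I A ξ) = 0) :
    inner ℂ η (amplification I T ξ) = 0 := by
  classical
  let K : Submodule ℂ (lp (fun _ : I => H) 2) :=
    (Submodule.span ℂ ((fun A => amplification I A ξ) '' Λ)).topologicalClosure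
  have hKc : IsClosed (K : Set (lp (fun _ : I => H) 2)) := Submodule.isClosed_topologicalClosure _
  have : CompleteSpace K := hKc.completeSpace_coe
  have hsub : ∀ A ∈ Λ, amplification I A ξ ∈ K := fun A hA =>
    Submodule.le_topologicalClosure _ (Submodule.subset_span ⟨A, hA, rfl⟩)
  have hmin : ∀ L : Submodule ℂ (lp (fun _ : I => H) 2),
      IsClosed (L : Set (lp (fun _ : I => H) 2)) → (∀ A ∈ Λ, amplification I A ξ ∈ L) → K ≤ L :=
    fun L hL h => Submodule.topologicalClosure_minimal _
      (Submodule.span_le.2 (by rintro _ ⟨A, hA, rfl⟩; exact h A hA)) hL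
  have hinv : ∀ A ∈ Λ, ∀ x ∈ K, amplification I A x ∈ K := fun A hA =>
    hmin (K.comap (amplification I A).toLinearMap) (hKc.preimage (amplification I A).continuous)
      fun B hB => hsub (A * B) (Λ.mul_mem hA hB)
  have hadj : ∀ (A : H →L[ℂ] H) (x y : lp (fun _ : I => H) 2),
      inner ℂ (amplification I A x) y = inner ℂ x (amplification I (ContinuousLinearMap.adjoint A) y) :=
    fun A x y => by
      rw [lp.inner_eq_tsum, lp.inner_eq_tsum]
      exact tsum_congr fun i => (ContinuousLinearMap.adjoint_inner_right A (x i) (y i)).symm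
  have hcomm : ∀ A ∈ Λ, ∀ x, K.starProjection (amplification I A x) =
      amplification I A (K.starProjection x) := fun A hA x => by
    refine (Submodule.eq_starProjection_of_mem_of_inner_eq_zero
      (hinv A hA _ (K.starProjection_apply_mem x)) fun w hw => ?_)
    rw [← map_sub, hadj]
    exact Submodule.starProjection_inner_eq_zero x _ (hinv _ (hΛ A hA) w hw)
  have hcommT : ∀ x, K.starProjection (amplification I T x) =
      amplification I T (K.starProjection x) := by
    have : K.starProjection ∘L amplification I T = amplification I T ∘L K.starProjection := by
      refine lp.ext_continuousLinearMap (by simp) fun j => ?_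
      ext1 v
      refine lp.ext (funext fun i => ?_)
      let S : H →L[ℂ] H := lp.evalCLM ℂ (fun _ : I => H) 2 i ∘L K.starProjection ∘L
        lp.singleContinuousLinearMap ℂ (fun _ : I => H) 2 j
      have hsingle : ∀ (A : H →L[ℂ] H) v, amplification I A (lp.single 2 j v) = lp.single 2 j (A v) :=
        fun A v => lp.ext (funext fun k => by
          rw [amplification_apply]
          by_cases hk : k = j
          · subst hk
            rw [lp.single_apply_self, lp.single_apply_self]
          · rw [lp.single_apply_ne _ _ _ hk, lp.single_apply_ne _ _ _ hk, map_zero])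
      have hS := hT S fun A hA => by
        ext v
        change (K.starProjection (lp.single 2 j (A v))) i = A ((K.starProjection (lp.single 2 j v)) i)
        rw [← hsingle, hcomm A hA]
        rfl
      have h1 := DFunLike.congr_fun hS v
      change (K.starProjection (lp.single 2 j (T v))) i =
        T ((K.starProjection (lp.single 2 j v)) i) at h1
      rw [← hsingle] at h1
      exact h1
    exact fun x => DFunLike.congr_fun this x
  have hξ : ξ ∈ K := hsub 1 Λ.one_mem
  have hTξ : amplification I T ξ ∈ K := by
    have := hcommT ξ
    rw [Submodule.starProjection_eq_self_iff.2 hξ] at this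
    exact Submodule.starProjection_eq_self_iff.1 this
  exact hmin (LinearMap.ker (innerSL ℂ η).toLinearMap)
    ((innerSL ℂ η).isClosed_ker) h hTξ

end bicommutant

/-! ### The group von Neumann algebra and its predual -/

section predual

variable {G : Type*} [Group G]

lemma leftRegular_mul (x y : G) : leftRegular (x * y) = leftRegular x * leftRegular y := by
  refine ContinuousLinearMap.ext fun f => lp.ext (E := fun _ : G => ℂ) (funext fun z => ?_)
  change f ((x * y)⁻¹ * z) = f (y⁻¹ * (x⁻¹ * z))
  rw [_root_.mul_inv_rev, mul_assoc]

lemma leftRegular_one : leftRegular (1 : G) = 1 := by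
  refine ContinuousLinearMap.ext fun f => lp.ext (E := fun _ : G => ℂ) (funext fun z => ?_)
  change f ((1 : G)⁻¹ * z) = f z
  rw [inv_one, one_mul]

lemma adjoint_leftRegular (x : G) :
    ContinuousLinearMap.adjoint (leftRegular x) = leftRegular x⁻¹ := by
  refine ((ContinuousLinearMap.eq_adjoint_iff _ _).2 fun f g => ?_).symm
  rw [lp.inner_eq_tsum, lp.inner_eq_tsum]
  refine Eq.trans (tsum_congr fun y => ?_)
    ((Equiv.mulLeft x).tsum_eq fun y => inner ℂ (f y) (g (x⁻¹ * y)))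
  change inner ℂ (f (x⁻¹⁻¹ * y)) (g y) = inner ℂ (f (x * y)) (g (x⁻¹ * (x * y)))
  rw [inv_inv, inv_mul_cancel_left]

variable (G) in
/-- The image of the left regular representation. -/
def leftRegularMonoid : Submonoid (EllTwo G →L[ℂ] EllTwo G) where
  carrier := Set.range leftRegular
  one_mem' := ⟨1, leftRegular_one⟩
  mul_mem' := by
    rintro _ _ ⟨x, rfl⟩ ⟨y, rfl⟩
    exact ⟨x * y, leftRegular_mul x y⟩

lemma norm_VN_of_le (x : G) : ‖VN.of x‖ ≤ 1 :=
  show ‖leftRegular x‖ ≤ 1 by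
    unfold leftRegular
    exact LinearMap.mkContinuous_norm_le _ zero_le_one _

/-- A weak operator closed condition which holds on the span of the operators `λ(x)` holds on
`VN(G)`. -/
lemma VN.induction_on {p : (EllTwo G →L[ℂ] EllTwo G) → Prop}
    (hcl : IsClosed {A : EllTwo G →WOT[ℂ] EllTwo G | p A.toCLM})
    (hspan : ∀ A ∈ Submodule.span ℂ (Set.range (leftRegular (G := G))), p A) (T : VN G) : p T.op :=
  closure_minimal (fun A hA => hspan A.toCLM hA) hcl T.2

/-- `VN(G)` is contained in the bicommutant of the operators `λ(x)`. -/
lemma VN.commute (T : VN G) (S : EllTwo G →L[ℂ] EllTwo G)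
    (hS : ∀ A ∈ leftRegularMonoid G, S * A = A * S) : S * T.op = T.op * S := by
  have key : ∀ ξ η : EllTwo G, inner ℂ η (S (T.op ξ)) = inner ℂ η (T.op (S ξ)) := by
    intro ξ η
    refine VN.induction_on (p := fun A => inner ℂ η (S (A ξ)) = inner ℂ η (A (S ξ))) ?_ ?_ T
    · refine isClosed_eq ?_ ?_
      · exact ContinuousLinearMapWOT.continuous_dual_apply ξ (innerSL ℂ η ∘L S)
      · exact ContinuousLinearMapWOT.continuous_dual_apply (S ξ) (innerSL ℂ η)
    · intro A hA
      have : A ∈ LinearMap.ker (LinearMap.mulLeft ℂ S - LinearMap.mulRight ℂ S) :=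
        Submodule.span_le.2 (by
          rintro _ ⟨x, rfl⟩
          exact sub_eq_zero.2 (hS _ ⟨x, rfl⟩)) hA
      have h : S * A = A * S := sub_eq_zero.1 this
      exact congrArg (fun B : EllTwo G →L[ℂ] EllTwo G => inner ℂ η (B ξ)) h
  ext1 ξ
  exact ext_inner_left ℂ fun η => key ξ η

/-- If every combination of finitely many linear functionals that vanishes on a subspace vanishes
at `v`, then some element of the subspace agrees with `v` on all of them. -/
lemma exists_mem_forall_eq {M α : Type*} [AddCommGroup M] [Module ℂ M] (N : Submodule ℂ M) (v : M)
    (J : Finset α) (g : α → M →ₗ[ℂ] ℂ)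
    (h : ∀ c : α → ℂ, (∀ w ∈ N, ∑ j ∈ J, c j * g j w = 0) → ∑ j ∈ J, c j * g j v = 0) :
    ∃ w ∈ N, ∀ j ∈ J, g j w = g j v := by
  classical
  let Θ : M →ₗ[ℂ] (J → ℂ) := LinearMap.pi fun j => g j
  have hv : Θ v ∈ N.map Θ := by
    by_contra hc
    obtain ⟨f, hf, hker⟩ := Submodule.exists_le_ker_of_notMem hc
    let c : α → ℂ := fun j => if hj : j ∈ J then f (Pi.single ⟨j, hj⟩ 1) else 0
    have hfc : ∀ w, f (Θ w) = ∑ j ∈ J, c j * g j w := fun w => by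
      rw [LinearMap.pi_apply_eq_sum_univ f, ← Finset.sum_coe_sort J]
      refine Finset.sum_congr rfl fun j _ => ?_
      have : c j = f (Pi.single j 1) := by simp [c]
      rw [this, mul_comm, smul_eq_mul]
      congr 2
      ext i
      simp [Pi.single_apply, eq_comm]
    refine hf ?_
    rw [hfc]
    refine h c fun w hw => ?_
    rw [← hfc]
    exact LinearMap.mem_ker.1 (hker (Submodule.mem_map_of_mem hw))
  obtain ⟨w, hw, hwv⟩ := hv
  exact ⟨w, hw, fun j hj => congrFun hwv ⟨j, hj⟩⟩

/-- An operator on which every finite combination of matrix coefficients that vanishes on the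
operators `λ(x)` vanishes, belongs to `VN(G)`. -/
lemma mem_vnSubspace (B : EllTwo G →L[ℂ] EllTwo G)
    (h : ∀ (J : Finset (EllTwo G × StrongDual ℂ (EllTwo G)))
      (c : EllTwo G × StrongDual ℂ (EllTwo G) → ℂ),
      (∀ x : G, ∑ j ∈ J, c j * j.2 (leftRegular x j.1) = 0) → ∑ j ∈ J, c j * j.2 (B j.1) = 0) :
    B ∈ vnSubspace G := by
  classical
  change ContinuousLinearMapWOT.ofCLM B ∈ closure
    {A : EllTwo G →WOT[ℂ] EllTwo G | A.toCLM ∈ Submodule.span ℂ (Set.range (leftRegular (G := G)))}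
  have hind : Topology.IsInducing (ContinuousLinearMapWOT.inducingFn (RingHom.id ℂ) (EllTwo G)
    (EllTwo G)) := ⟨rfl⟩
  rw [hind.closure_eq_preimage_closure_image, Set.mem_preimage, mem_closure_iff]
  intro U hU hBU
  obtain ⟨J, u, hu, hJU⟩ := isOpen_pi_iff.1 hU _ hBU
  obtain ⟨A, hA, hAB⟩ := exists_mem_forall_eq (Submodule.span ℂ (Set.range (leftRegular (G := G)))) B
    J (fun j => j.2.toLinearMap ∘ₗ (ContinuousLinearMap.apply ℂ (EllTwo G) j.1).toLinearMap)
    fun c hc => h J c fun x => hc _ (Submodule.subset_span (Set.mem_range_self x))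
  refine ⟨ContinuousLinearMapWOT.inducingFn (RingHom.id ℂ) _ _ (ContinuousLinearMapWOT.ofCLM A),
    hJU fun j hj => ?_, ⟨_, hA, rfl⟩⟩
  have h1 : j.2 (A j.1) = j.2 (B j.1) := hAB j hj
  have h2 := (hu j hj).2
  change j.2 (B j.1) ∈ u j at h2
  change j.2 (A j.1) ∈ u j
  rwa [h1]

/-- The vector functional as an element of the predual. -/
def VNPredual.vector (ξ η : EllTwo G) : VNPredual G :=
  ⟨vectorFunctional ξ η, Submodule.le_topologicalClosure _ (Submodule.subset_span ⟨(ξ, η), rfl⟩)⟩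

namespace VNPredual

lemma vector_functional (ξ η : EllTwo G) (T : VN G) :
    (vector ξ η).functional T = inner ℂ η (T.op ξ) := rfl

lemma norm_vector_le (ξ η : EllTwo G) : ‖vector ξ η‖ ≤ ‖ξ‖ * ‖η‖ :=
  show ‖vectorFunctional ξ η‖ ≤ _ by
    unfold vectorFunctional
    exact CB.norm_mk_le _ (by positivity) _

protected lemma ext {φ ψ : VNPredual G} (h : ∀ T, φ.functional T = ψ.functional T) : φ = ψ :=
  Subtype.ext (CB.ext h)

/-- Evaluation of normal functionals at an element of `VN(G)`. -/
def evalCLM (T : VN G) : VNPredual G →L[ℂ] ℂ :=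
  LinearMap.mkContinuous
    { toFun := fun φ => φ.functional T, map_add' := fun _ _ => rfl, map_smul' := fun _ _ => rfl } ‖T‖
    fun φ => by
      rw [mul_comm]
      exact CB.norm_apply_le φ.functional T

lemma evalCLM_apply (T : VN G) (φ : VNPredual G) : evalCLM T φ = φ.functional T := rfl

/-- The inclusion of the predual in the dual of `VN(G)`. -/
def functionalₗ : VNPredual G →ₗ[ℂ] OpDual (VN G) :=
  { toFun := functional, map_add' := fun _ _ => rfl, map_smul' := fun _ _ => rfl }

/-- Continuous linear functionals on the predual which agree on vector functionals are equal. -/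
lemma clm_ext {F F' : VNPredual G →L[ℂ] ℂ} (h : ∀ ξ η, F (vector ξ η) = F' (vector ξ η)) :
    F = F' := by
  have hd : Dense ((Submodule.span ℂ (Set.range fun p : EllTwo G × EllTwo G =>
      vector p.1 p.2) : Submodule ℂ (VNPredual G)) : Set (VNPredual G)) := by
    intro φ
    refine (closure_subtype (x := φ)).2 ?_
    have h : (φ.functional : OpDual (VN G)) ∈
        closure ((Submodule.span ℂ (Set.range fun p : EllTwo G × EllTwo G =>
          vectorFunctional p.1 p.2) : Submodule ℂ (OpDual (VN G))) : Set (OpDual (VN G))) := φ.2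
    refine closure_mono ?_ h
    have : Submodule.span ℂ (Set.range fun p : EllTwo G × EllTwo G => vectorFunctional p.1 p.2) ≤
        (Submodule.span ℂ (Set.range fun p : EllTwo G × EllTwo G =>
          vector p.1 p.2)).map functionalₗ := by
      rw [Submodule.span_le]
      rintro _ ⟨p, rfl⟩
      exact ⟨_, Submodule.subset_span ⟨p, rfl⟩, rfl⟩
    exact this
  refine ContinuousLinearMap.ext_on hd ?_
  rintro _ ⟨p, rfl⟩
  exact h p.1 p.2

/-- The dual of the predual is `VN(G)`: a bounded functional on the predual defines a bounded
sesquilinear form, hence an operator `B`, and `B` lies in `VN(G)` since the functional kills the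
combinations of vector functionals that vanish on `VN(G)`. -/
lemma exists_eq_evalCLM (F : VNPredual G →L[ℂ] ℂ) (hF : ∀ ξ η : EllTwo G, ‖ξ‖ ≤ 1 → ‖η‖ ≤ 1 →
    ‖F (vector ξ η)‖ ≤ 1) : ∃ B : VN G, ‖B‖ ≤ 1 ∧ F = evalCLM B := by
  have hF' : ∀ ξ η, ‖F (vector ξ η)‖ ≤ ‖F‖ * (‖ξ‖ * ‖η‖) := fun ξ η =>
    (F.le_opNorm _).trans (mul_le_mul_of_nonneg_left (norm_vector_le ξ η) (norm_nonneg F))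
  let b : EllTwo G →L⋆[ℂ] EllTwo G →L[ℂ] ℂ := LinearMap.mkContinuous₂
    (LinearMap.mk₂'ₛₗ (starRingEnd ℂ) (RingHom.id ℂ) (fun η ξ => F (vector ξ η))
      (fun η η' ξ => by
        rw [← map_add]
        exact congrArg F (VNPredual.ext fun T => inner_add_left η η' (T.op ξ)))
      (fun c η ξ => by
        rw [← map_smul]
        exact congrArg F (VNPredual.ext fun T => inner_smul_left η (T.op ξ) c))
      (fun η ξ ξ' => by
        rw [← map_add]
        refine congrArg F (VNPredual.ext fun T => ?_)
        change inner ℂ η (T.op (ξ + ξ')) = inner ℂ η (T.op ξ) + inner ℂ η (T.op ξ')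
        rw [map_add, inner_add_right])
      (fun c η ξ => by
        rw [RingHom.id_apply, ← map_smul]
        refine congrArg F (VNPredual.ext fun T => ?_)
        change inner ℂ η (T.op (c • ξ)) = c • inner ℂ η (T.op ξ)
        rw [map_smul, inner_smul_right, smul_eq_mul])) ‖F‖ fun η ξ => by
    refine (hF' ξ η).trans (le_of_eq ?_)
    ring
  let B : EllTwo G →L[ℂ] EllTwo G :=
    ContinuousLinearMap.adjoint (InnerProductSpace.continuousLinearMapOfBilin b)
  have hB : ∀ ξ η, inner ℂ η (B ξ) = F (vector ξ η) := fun ξ η => by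
    rw [ContinuousLinearMap.adjoint_inner_right,
      InnerProductSpace.continuousLinearMapOfBilin_apply]
    rfl
  have hBle : ‖B‖ ≤ 1 := by
    refine ContinuousLinearMap.opNorm_le_of_unit_norm zero_le_one fun ξ hξ => ?_
    by_cases h0 : B ξ = 0
    · rw [h0, norm_zero]
      exact zero_le_one
    have h1 := hF ξ (((‖B ξ‖⁻¹ : ℝ) : ℂ) • B ξ) hξ.le (by
      rw [norm_smul, Complex.norm_real, norm_inv, norm_norm, inv_mul_cancel₀ (norm_ne_zero_iff.2 h0)])
    rw [← hB, inner_smul_left, inner_self_eq_norm_sq_to_K, norm_mul, RCLike.norm_conj,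
      Complex.norm_real, norm_inv, norm_norm] at h1
    have h2 : 0 < ‖B ξ‖ := norm_pos_iff.2 h0
    have h3 : ‖((‖B ξ‖ : ℂ) ^ 2)‖ = ‖B ξ‖ ^ 2 := by
      rw [norm_pow, Complex.norm_real, norm_norm]
    have h4 : ‖B ξ‖⁻¹ * ‖B ξ‖ ^ 2 ≤ 1 := h3 ▸ h1
    rwa [pow_two, inv_mul_cancel_left₀ h2.ne'] at h4
  have hmem : B ∈ vnSubspace G := by
    refine mem_vnSubspace B fun J c hJ => ?_
    let φ : VNPredual G := ∑ j ∈ J, c j • vector j.1 ((InnerProductSpace.toDual ℂ _).symm j.2)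
    have hφT : ∀ T : VN G, φ.functional T = ∑ j ∈ J, c j * j.2 (T.op j.1) := fun T => by
      change evalCLM T φ = _
      simp only [φ, map_sum, map_smul, smul_eq_mul]
      refine Finset.sum_congr rfl fun j _ => ?_
      rw [evalCLM_apply, vector_functional, InnerProductSpace.toDual_symm_apply]
    have hφ : φ = 0 := VNPredual.ext fun T => by
      rw [hφT]
      refine VN.induction_on (p := fun A => ∑ j ∈ J, c j * j.2 (A j.1) = 0) ?_ ?_ T
      · exact isClosed_eq (continuous_finsetSum _ fun j _ => continuous_const.mul
          (ContinuousLinearMapWOT.continuous_dual_apply j.1 j.2)) continuous_const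
      · intro A hA
        refine Submodule.span_induction ?_ ?_ ?_ ?_ hA
        · rintro _ ⟨x, rfl⟩
          exact hJ x
        · simp
        · intro A A' _ _ h h'
          simp only [_root_.add_apply, map_add, mul_add, Finset.sum_add_distrib, h, h', add_zero]
        · intro a A _ h
          simp only [_root_.smul_apply, map_smul, smul_eq_mul, mul_left_comm _ a,
            ← Finset.mul_sum, h, mul_zero]
    have h0 : F φ = 0 := by rw [hφ, map_zero]
    simp only [φ, map_sum, map_smul, smul_eq_mul] at h0
    rw [← h0]
    refine Finset.sum_congr rfl fun j _ => ?_
    rw [← hB, InnerProductSpace.toDual_symm_apply]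
  refine ⟨⟨B, hmem⟩, hBle, clm_ext fun ξ η => ?_⟩
  rw [← hB]
  rfl

/-- A normal functional on `VN(G)` is a sum of vector functionals with summable coefficients. -/
lemma exists_hasSum (φ : VNPredual G) :
    ∃ c : {p : EllTwo G × EllTwo G // ‖p.1‖ ≤ 1 ∧ ‖p.2‖ ≤ 1} → ℂ, (Summable fun i => ‖c i‖) ∧
      HasSum (fun i => c i • vector i.1.1 i.1.2) φ := by
  refine exists_hasSum_of_norming (fun i : {p : EllTwo G × EllTwo G // ‖p.1‖ ≤ 1 ∧ ‖p.2‖ ≤ 1} =>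
    vector i.1.1 i.1.2) (fun i => ?_) (fun F hF ψ => ?_) φ
  · exact (norm_vector_le _ _).trans (mul_le_one₀ i.2.1 (norm_nonneg _) i.2.2)
  · obtain ⟨B, hB, rfl⟩ := exists_eq_evalCLM F fun ξ η hξ hη => hF ⟨(ξ, η), hξ, hη⟩
    refine (CB.norm_apply_le ψ.functional B).trans ?_
    exact mul_le_of_le_one_right (norm_nonneg ψ) hB

end VNPredual

/-- A normal functional on `VN(G)` is determined by its values at the operators `λ(x)`: it is a
vector functional of an amplification, to which the bicommutant argument applies. -/
lemma ker_predualToFun : LinearMap.ker (predualToFun G) = ⊥ := by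
  rw [LinearMap.ker_eq_bot']
  intro φ hφ
  have hφx : ∀ x, φ.functional (VN.of x) = 0 := fun x => congrFun hφ x
  obtain ⟨c, hc, hsum⟩ := φ.exists_hasSum
  have hmem : ∀ f : {p : EllTwo G × EllTwo G // ‖p.1‖ ≤ 1 ∧ ‖p.2‖ ≤ 1} → EllTwo G,
      (∀ i, ‖f i‖ ≤ Real.sqrt ‖c i‖) → Memℓp f 2 := fun f hf => by
    refine memℓp_gen (Summable.of_nonneg_of_le (fun i => by positivity) (fun i => ?_) hc)
    rw [ENNReal.toReal_ofNat, Real.rpow_two, ← Real.sq_sqrt (norm_nonneg (c i))]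
    exact pow_le_pow_left₀ (norm_nonneg _) (hf i) 2
  -- distribute the coefficient `c i` evenly over the two vectors
  let ξ : lp (fun _ : {p : EllTwo G × EllTwo G // ‖p.1‖ ≤ 1 ∧ ‖p.2‖ ≤ 1} => EllTwo G) 2 :=
    ⟨fun i => (Real.sqrt ‖c i‖ : ℂ) • i.1.1, hmem _ fun i => by
      rw [norm_smul, Complex.norm_real, Real.norm_of_nonneg (Real.sqrt_nonneg _)]
      exact mul_le_of_le_one_right (Real.sqrt_nonneg _) i.2.1⟩
  let η : lp (fun _ : {p : EllTwo G × EllTwo G // ‖p.1‖ ≤ 1 ∧ ‖p.2‖ ≤ 1} => EllTwo G) 2 :=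
    ⟨fun i => (starRingEnd ℂ) (c i / Real.sqrt ‖c i‖) • i.1.2, hmem _ fun i => by
      rw [norm_smul, RCLike.norm_conj, norm_div, Complex.norm_real,
        Real.norm_of_nonneg (Real.sqrt_nonneg _), Real.div_sqrt]
      exact mul_le_of_le_one_right (Real.sqrt_nonneg _) i.2.2⟩
  have hφT : ∀ T : VN G, φ.functional T = inner ℂ η (amplification _ T.op ξ) := fun T => by
    have h1 := hsum.mapL (VNPredual.evalCLM T)
    have h2 := lp.hasSum_inner (𝕜 := ℂ)
      (G := fun _ : {p : EllTwo G × EllTwo G // ‖p.1‖ ≤ 1 ∧ ‖p.2‖ ≤ 1} => EllTwo G) η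
      (amplification _ T.op ξ)
    have e : (fun i => VNPredual.evalCLM T (c i • VNPredual.vector i.1.1 i.1.2)) =
        fun i => inner ℂ (η i) (amplification _ T.op ξ i) := funext fun i => by
      rw [map_smul, VNPredual.evalCLM_apply, VNPredual.vector_functional, smul_eq_mul]
      change _ = inner ℂ ((starRingEnd ℂ) (c i / Real.sqrt ‖c i‖) • i.1.2)
        (T.op ((Real.sqrt ‖c i‖ : ℂ) • i.1.1))
      rw [map_smul, inner_smul_left, inner_smul_right, Complex.conj_conj, ← mul_assoc]
      by_cases hci : c i = 0
      · simp [hci]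
      · rw [div_mul_cancel₀]
        simpa using hci
    rw [e] at h1
    exact h1.unique h2
  refine VNPredual.ext fun T => ?_
  rw [hφT]
  refine inner_amplification_eq_zero (leftRegularMonoid G) ?_ T.op T.commute ξ η ?_
  · rintro _ ⟨x, rfl⟩
    exact ⟨x⁻¹, (adjoint_leftRegular x).symm⟩
  · rintro _ ⟨x, rfl⟩
    exact (hφT (VN.of x)).symm.trans (hφx x)

/-- The matrix norms of `A(G)` are determined by the elements of the dual `VN(G)`. -/
lemma FourierAlgebra.isDualNormed : IsDualNormed (FourierAlgebra G) := by
  have hker : LinearMap.ker (predualToFun G) ≤ LinearMap.ker VNPredual.functionalₗ := by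
    rw [ker_predualToFun]
    exact bot_le
  let J : FourierAlgebra G →ₗ[ℂ] OpDual (VN G) :=
    (LinearMap.ker (predualToFun G)).liftQ VNPredual.functionalₗ hker
  refine (IsDualNormed.opDual (V := VN G)).of_isometry J fun ι _ x => ?_
  have hmap : ∀ y : Matrix ι ι (VNPredual G), y.map (LinearMap.ker (predualToFun G)).mkQ = x →
      mnorm (x.map J) = mnorm y := fun y hy => by
    have e : x.map J = y.map VNPredual.functional := by
      ext1 i j
      have : (LinearMap.ker (predualToFun G)).mkQ (y i j) = x i j := congrFun (congrFun hy i) j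
      change J (x i j) = _
      rw [← this]
      rfl
    rw [e]
    rfl
  apply le_antisymm
  · exact le_quotientNorm _ _ fun y hy => (hmap y hy).le
  · obtain ⟨y, hy⟩ := quotient_lift (LinearMap.ker (predualToFun G)) x
    have h := quotientNorm_le (LinearMap.ker (predualToFun G)) y
    rw [hy] at h
    exact h.trans (hmap y hy).ge

end predual

/-! ### Tensoring matrices with scalar matrices -/

section scalar

variable {V : Type*} [NormedAddCommGroup V] [NormedSpace ℂ V] [OperatorSpace V]
  {ι κ : Type} [Fintype ι] [Fintype κ]

namespace OperatorSpace

lemma mnorm_blockDiagonal_le (x : Matrix κ κ V) (n : ℕ) :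
    mnorm (Matrix.of fun p q : Fin n × κ => if p.1 = q.1 then x p.2 q.2 else 0) ≤ mnorm x := by
  induction n with
  | zero =>
    have e : (Matrix.of fun p q : Fin 0 × κ => if p.1 = q.1 then x p.2 q.2 else 0) = 0 := by
      ext p
      exact p.1.elim0
    rw [e, mnorm_zero]
    exact mnorm_nonneg x
  | succ n ih =>
    let f : κ ⊕ Fin n × κ ≃ Fin (n + 1) × κ :=
      { toFun := Sum.elim (fun k => (0, k)) fun p => (p.1.succ, p.2)
        invFun := fun p => Fin.cases (Sum.inl p.2) (fun i => Sum.inr (i, p.2)) p.1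
        left_inv := by rintro (k | p) <;> rfl
        right_inv := by
          rintro ⟨i, k⟩
          induction i using Fin.cases <;> rfl }
    rw [← mnorm_reindex f]
    have e : (Matrix.of fun p q : Fin (n + 1) × κ =>
        if p.1 = q.1 then x p.2 q.2 else 0).submatrix f f = Matrix.fromBlocks x 0 0
          (Matrix.of fun p q : Fin n × κ => if p.1 = q.1 then x p.2 q.2 else 0) := by
      ext (k | p) (l | q) <;> simp [f, Fin.succ_ne_zero, (Fin.succ_ne_zero _).symm]
    rw [e, mnorm_fromBlocks]
    exact max_le le_rfl ih

/-- The tensor product of a scalar matrix with a matrix over `V`. -/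
lemma mnorm_kronecker_le (c : Matrix ι ι ℂ) (x : Matrix κ κ V) :
    mnorm (Matrix.of fun p q : ι × κ => c p.1 q.1 • x p.2 q.2) ≤ mnorm c * mnorm x := by
  classical
  have hd : mnorm (Matrix.of fun p q : ι × κ => if p.1 = q.1 then x p.2 q.2 else 0) ≤ mnorm x := by
    refine le_trans (le_of_eq ?_) (mnorm_blockDiagonal_le x (Fintype.card ι))
    rw [← mnorm_reindex ((Fintype.equivFin ι).symm.prodCongr (Equiv.refl κ))]
    congr 1
    ext p q
    simp
  have h1 : ‖(1 : Matrix (ι × κ) (ι × κ) ℂ)‖ ≤ 1 :=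
    l2_le _ zero_le_one fun y => by simp [Matrix.one_apply]
  have h := mnorm_scalarMulMul_le' (ampl κ c)
    (Matrix.of fun p q : ι × κ => if p.1 = q.1 then x p.2 q.2 else 0) 1 (l2_ampl c) h1
  have e : scalarMulMul (ampl κ c)
      (Matrix.of fun p q : ι × κ => if p.1 = q.1 then x p.2 q.2 else 0) 1 =
      Matrix.of fun p q : ι × κ => c p.1 q.1 • x p.2 q.2 := by
    ext ⟨i, k⟩ ⟨j, l⟩
    simp only [scalarMulMul, ampl, Matrix.of_apply, Matrix.one_apply, Fintype.sum_prod_type,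
      mul_ite, mul_one, mul_zero, ite_smul, zero_smul, smul_ite, smul_zero, Prod.mk.injEq]
    rw [Finset.sum_eq_single j, Finset.sum_eq_single k, Finset.sum_eq_single j,
      Finset.sum_eq_single l] <;> simp +contextual [eq_comm]
  rw [e, mul_one] at h
  rw [mnorm_complex c]
  exact h.trans (mul_le_mul_of_nonneg_left hd (norm_nonneg c))

end OperatorSpace

end scalar

/-! ### The operator space `ℓ¹(G)` -/

namespace EllOne

variable {G : Type*} {ι κ : Type} [Fintype ι] [Fintype κ]

lemma norm_entry_le_of {T : G → Matrix κ κ ℂ} {D : ℝ} (hT : ∀ s, mnorm (T s) ≤ D) (s : G)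
    (k l : κ) : ‖T s k l‖ ≤ D :=
  (norm_entry_le (T s) k l).trans (hT s)

lemma summable_mul (f : EllOne G) {t : G → ℂ} {D : ℝ} (ht : ∀ s, ‖t s‖ ≤ D) :
    Summable fun s => f s * t s := by
  refine Summable.of_norm_bounded ((ellOne_hasSum f).summable.mul_right D) fun s => ?_
  rw [norm_mul]
  exact mul_le_mul_of_nonneg_left (ht s) (norm_nonneg _)

/-- A family of matrices bounded by `D`, of any finite size, is `D` times one of the tests that
define the norms of `ℓ¹(G)`. -/
lemma mnorm_tsum_le (f : Matrix ι ι (EllOne G)) (T : G → Matrix κ κ ℂ) {D : ℝ} (hD : 0 ≤ D)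
    (hT : ∀ s, mnorm (T s) ≤ D) :
    mnorm (Matrix.of fun p q : ι × κ => ∑' s, f p.1 q.1 s * T s p.2 q.2) ≤ D * mnorm f := by
  classical
  rcases hD.eq_or_lt with rfl | hD
  · have hT0 : ∀ s k l, T s k l = 0 := fun s k l =>
      norm_le_zero_iff.1 (norm_entry_le_of hT s k l)
    have e : (Matrix.of fun p q : ι × κ => ∑' s, f p.1 q.1 s * T s p.2 q.2) = 0 := by
      ext p q
      simp [hT0]
    rw [e, mnorm_zero, zero_mul]
  let e := Fintype.equivFin κ
  let t : EllInftyBall G := ⟨Fintype.card κ,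
    fun s => ((D⁻¹ : ℝ) : ℂ) • (T s).submatrix e.symm e.symm, fun s => by
      rw [← mnorm_complex]
      refine (mnorm_smul_le _ _).trans ?_
      rw [mnorm_reindex, Complex.norm_real, Real.norm_of_nonneg (by positivity),
        inv_mul_le_one₀ hD]
      exact hT s⟩
  have h1 : mnorm (testMatrix (fun t : EllInftyBall G => Fin t.1) ellOneTest t f) ≤ mnorm f :=
    le_ciSup (testMatrix_bdd (fun t : EllInftyBall G => Fin t.1) ellOneTest ellOneTest_bdd f) t
  have h2 : (Matrix.of fun p q : ι × κ => ∑' s, f p.1 q.1 s * T s p.2 q.2) = ((D : ℝ) : ℂ) •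
      (testMatrix (fun t : EllInftyBall G => Fin t.1) ellOneTest t f).submatrix
        ((Equiv.refl ι).prodCongr e) ((Equiv.refl ι).prodCongr e) := by
    ext ⟨i, k⟩ ⟨j, l⟩
    have h3 : HasSum (fun s => f i j s • t.2.1 s) (ellOneTest t (f i j)) :=
      (ellOne_summable t (f i j)).hasSum
    have h4 := (Pi.hasSum.1 (Pi.hasSum.1 h3 (e k)) (e l)).mul_left ((D : ℝ) : ℂ)
    refine Eq.trans (tsum_congr fun s => ?_) h4.tsum_eq
    change f i j s * T s k l =
      ((D : ℝ) : ℂ) * (f i j s * (((D⁻¹ : ℝ) : ℂ) * T s (e.symm (e k)) (e.symm (e l))))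
    rw [e.symm_apply_apply, e.symm_apply_apply, mul_left_comm, ← mul_assoc ((D : ℝ) : ℂ),
      ← Complex.ofReal_mul, mul_inv_cancel₀ hD.ne', Complex.ofReal_one, one_mul]
  rw [h2]
  refine (mnorm_smul_le _ _).trans ?_
  rw [Complex.norm_real, Real.norm_of_nonneg hD.le, mnorm_reindex]
  exact mul_le_mul_of_nonneg_left h1 hD.le

/-- The matrix norms of `ℓ¹(G)` are determined by the pairing with matrices over `ℓ^∞(G)`. -/
lemma mnorm_le (f : Matrix ι ι (EllOne G)) {C : ℝ}
    (h : ∀ (n : ℕ) (T : G → Matrix (Fin n) (Fin n) ℂ), (∀ s, mnorm (T s) ≤ 1) →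
      mnorm (Matrix.of fun p q : ι × Fin n => ∑' s, f p.1 q.1 s * T s p.2 q.2) ≤ C) :
    mnorm f ≤ C := by
  refine ciSup_le fun t => ?_
  refine le_trans (le_of_eq (congrArg mnorm ?_))
    (h t.1 t.2.1 fun s => (mnorm_complex _).le.trans (t.2.2 s))
  ext ⟨i, k⟩ ⟨j, l⟩
  have h3 : HasSum (fun s => f i j s • t.2.1 s) (ellOneTest t (f i j)) :=
    (ellOne_summable t (f i j)).hasSum
  exact (Pi.hasSum.1 (Pi.hasSum.1 h3 k) l).tsum_eq.symm

lemma isDualNormed : IsDualNormed (EllOne G) := by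
  intro ι _ f C hC h
  refine mnorm_le f fun n T hT => ?_
  have hTe : ∀ k l s, ‖T s k l‖ ≤ 1 := fun k l s => norm_entry_le_of hT s k l
  let ψ : Matrix (Fin n) (Fin n) (OpDual (EllOne G)) := Matrix.of fun k l => CB.mk
    { toFun := fun g => ∑' s, g s * T s k l
      map_add' := fun g g' => by
        rw [← (summable_mul g (hTe k l)).tsum_add (summable_mul g' (hTe k l))]
        exact tsum_congr fun s => add_mul _ _ _
      map_smul' := fun c g => by
        rw [RingHom.id_apply, ← (summable_mul g (hTe k l)).tsum_const_smul c]
        exact tsum_congr fun s => smul_mul_assoc c (g s) _ } 1 fun m g => by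
    refine le_trans (le_of_eq ?_)
      (mnorm_tsum_le g (fun s => Matrix.of fun _ _ : Unit => T s k l) zero_le_one fun s => by
        rw [mnorm_one_by_one]
        exact hTe k l s)
    rw [← mnorm_reindex (Equiv.prodPUnit.{0, 0} (Fin m))]
    rfl
  have hψ : mnorm ψ ≤ 1 := CB.mnorm_le _ zero_le_one fun m g => by
    refine le_trans (le_of_eq ?_) (mnorm_tsum_le g T zero_le_one hT)
    rw [← mnorm_reindex (Equiv.prodComm (Fin n) (Fin m))]
    rfl
  refine le_trans (le_of_eq ?_) (h _ ψ hψ)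
  rw [← mnorm_reindex (Equiv.prodComm (Fin n) ι)]
  rfl

variable [DecidableEq G]

lemma denseRange_linearCombination :
    DenseRange (Finsupp.linearCombination ℂ fun s : G => (lp.single 1 s (1 : ℂ) : EllOne G)) := by
  intro f
  refine mem_closure_of_tendsto (lp.hasSum_single (by simp) f) (Filter.Eventually.of_forall
    fun J => ⟨∑ s ∈ J, Finsupp.single s (f s), ?_⟩)
  rw [map_sum]
  refine Finset.sum_congr rfl fun s _ => ?_
  rw [Finsupp.linearCombination_single, ← lp.single_smul, smul_eq_mul, mul_one]

lemma linearCombination_apply (u : G →₀ ℂ) (t : G) :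
    Finsupp.linearCombination ℂ (fun s : G => (lp.single 1 s (1 : ℂ) : EllOne G)) u t = u t := by
  induction u using Finsupp.induction_linear with
  | zero => simp
  | add u v hu hv => rw [map_add, lp.coeFn_add, Pi.add_apply, hu, hv, Finsupp.add_apply]
  | single s c =>
    rw [Finsupp.linearCombination_single, ← lp.single_smul, smul_eq_mul, mul_one]
    by_cases h : t = s
    · subst h
      rw [lp.single_apply_self, Finsupp.single_eq_same]
    · rw [lp.single_apply_ne _ _ _ h, Finsupp.single_eq_of_ne h]

/-- Continuous linear maps on `ℓ¹(G)` which agree on the functions `δ_s` are equal. -/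
lemma clm_ext {E : Type*} [NormedAddCommGroup E] [NormedSpace ℂ E] {φ ψ : EllOne G →L[ℂ] E}
    (h : ∀ s, φ (lp.single 1 s 1) = ψ (lp.single 1 s 1)) : φ = ψ :=
  lp.ext_continuousLinearMap (by simp) fun s => ContinuousLinearMap.ext_ring (h s)

variable {V W : Type*} [NormedAddCommGroup V] [NormedSpace ℂ V] [OperatorSpace V]
  [NormedAddCommGroup W] [NormedSpace ℂ W] [OperatorSpace W]

/-- A bounded family of elementary tensors defines a completely bounded map on `ℓ¹(G)`: an element
of the unit ball of `M_n(CB(V, W*))` turns the family into a bounded family of matrices, and these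
are what `ℓ¹(G)` is tested against. -/
lemma exists_cb_tmul (v : G → V) (w : G → W) {C : ℝ} (hC : 0 ≤ C) (h : ∀ s, ‖v s‖ * ‖w s‖ ≤ C) :
    ∃ L : CB (EllOne G) (ProjTensor V W), ‖L‖ ≤ C ∧
      ∀ s, L (lp.single 1 s 1) = ProjTensor.tmul (v s) (w s) := by
  obtain ⟨L, hL, hLe⟩ := CB.exists_extension
    (Finsupp.linearCombination ℂ fun s : G => (lp.single 1 s (1 : ℂ) : EllOne G))
    (Finsupp.linearCombination ℂ fun s => ProjTensor.tmul (v s) (w s))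
    denseRange_linearCombination hC (by
      intro n x
      refine ProjTensor.mnorm_le _ (mul_nonneg hC (mnorm_nonneg _)) fun m Φ => ?_
      have hT : ∀ s, mnorm (Matrix.of fun k l => Φ k l (v s) (w s)) ≤ C * mnorm Φ := fun s => by
        refine (CB.mnorm_map_apply_le (Φ.map fun φ => φ (v s)) (w s)).trans ?_
        refine (mul_le_mul_of_nonneg_right (CB.mnorm_map_apply_le Φ (v s)) (norm_nonneg _)).trans ?_
        rw [mul_assoc, mul_comm C]
        exact mul_le_mul_of_nonneg_left (h s) (mnorm_nonneg Φ)
      have hs := mnorm_tsum_le (x.map (Finsupp.linearCombination ℂ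
        fun s : G => (lp.single 1 s (1 : ℂ) : EllOne G))) _ (mul_nonneg hC (mnorm_nonneg Φ)) hT
      refine le_trans (le_of_eq (congrArg mnorm ?_)) (hs.trans (le_of_eq (by ring)))
      ext ⟨i, k⟩ ⟨j, l⟩
      let ev : ProjTensor V W →ₗ[ℂ] ℂ :=
        { toFun := fun y => y.functional (Φ k l), map_add' := fun _ _ => rfl
          map_smul' := fun _ _ => rfl }
      change ev (Finsupp.linearCombination ℂ (fun s => ProjTensor.tmul (v s) (w s)) (x i j)) =
        ∑' s, Finsupp.linearCombination ℂ
          (fun s : G => (lp.single 1 s (1 : ℂ) : EllOne G)) (x i j) s * Φ k l (v s) (w s)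
      simp only [linearCombination_apply]
      rw [tsum_eq_sum (s := (x i j).support) fun s hs => by
        rw [Finsupp.notMem_support_iff.1 hs, zero_mul], Finsupp.linearCombination_apply,
        Finsupp.sum, map_sum]
      exact Finset.sum_congr rfl fun s _ => map_smul ev _ _)
  exact ⟨L, hL, fun s => by simpa using hLe (Finsupp.single s 1)⟩

end EllOne

/-! ### Modules over completely contractive Banach algebras -/

section modules

lemma CB.mnorm_mul_le {V : Type*} [NormedAddCommGroup V] [NormedSpace ℂ V] [OperatorSpace V]
    {ι κ : Type} [Fintype ι] [Fintype κ] (Φ : Matrix ι ι (CB V V)) (Ψ : Matrix κ κ (CB V V)) :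
    mnorm (Matrix.of fun p q : ι × κ => Φ p.1 q.1 * Ψ p.2 q.2) ≤ mnorm Φ * mnorm Ψ := by
  refine CB.mnorm_le _ (mul_nonneg (mnorm_nonneg Φ) (mnorm_nonneg Ψ)) fun n x => ?_
  rw [mul_assoc]
  refine le_trans (le_of_eq ?_) ((CB.mnorm_pair_le Φ (CB.pair Ψ x)).trans
    (mul_le_mul_of_nonneg_left (CB.mnorm_pair_le Ψ x) (mnorm_nonneg Φ)))
  rw [← mnorm_reindex (Equiv.prodAssoc ι κ (Fin n))]
  rfl

variable {A : Type*} [NonUnitalNormedRing A] [NormedSpace ℂ A] [OperatorSpace A]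

/-- The action of a fixed element of the algebra, as a bounded linear map. -/
def CBLeftModule.actCLM {X : Type*} [NormedAddCommGroup X] [NormedSpace ℂ X] [OperatorSpace X]
    (M : CBLeftModule A X) (a : A) : X →L[ℂ] X :=
  (M.act a).mkContinuous (‖M.π‖ * ‖a‖) fun x => by
    rw [← M.π_tmul, mul_assoc]
    exact (M.π.norm_apply_le _).trans
      (mul_le_mul_of_nonneg_left (ProjTensor.norm_tmul_le a x) (norm_nonneg _))

variable [IsScalarTower ℂ A A] [SMulCommClass ℂ A A]

lemma IsCompletelyContractive.of_isJointlyCB [CompleteSpace A] (hA : IsDualNormed A)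
    (h : IsJointlyCB (LinearMap.mul ℂ A) 1) : IsCompletelyContractive A :=
  ProjTensor.exists_lift hA (LinearMap.mul ℂ A) zero_le_one h

/-- The left module `A ⊗̂ W` with the action `a · (b ⊗ w) = ab ⊗ w`. -/
lemma exists_leftModule_projTensor (h : IsJointlyCB (LinearMap.mul ℂ A) 1) (W : Type*)
    [NormedAddCommGroup W] [NormedSpace ℂ W] [OperatorSpace W] :
    ∃ N : CBLeftModule A (ProjTensor A W), ∀ (a b : A) (w : W),
      N.act a (ProjTensor.tmul b w) = ProjTensor.tmul (a * b) w := by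
  -- left multiplication by `a` on `A`
  let l : A → CB A A := fun a => CB.mk (LinearMap.mul ℂ A a) ‖a‖ fun n x => by
    have h1 := h Unit (Fin n) (Matrix.of fun _ _ => a) x
    rw [mnorm_one_by_one, one_mul] at h1
    refine le_trans (le_of_eq ?_) h1
    rw [← mnorm_reindex (Equiv.punitProd.{0, 0} (Fin n))]
    rfl
  have hl : ∀ (a : A) (ι κ : Type) [Fintype ι] [Fintype κ] (x : Matrix ι ι A) (w : Matrix κ κ W),
      mnorm (Matrix.of fun p q : ι × κ => ProjTensor.tmul (a * x p.1 q.1) (w p.2 q.2)) ≤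
        ‖a‖ * mnorm x * mnorm w := fun a ι κ _ _ x w => by
    refine ProjTensor.mnorm_le _ (by have := mnorm_nonneg x; have := mnorm_nonneg w; positivity)
      fun m Φ => ?_
    have h1 := CB.mnorm_pair_le (CB.pair Φ (x.map (l a))) w
    have h2 := CB.mnorm_pair_le Φ (x.map (l a))
    have h3 := CB.mnorm_map_le (l a) x
    have h4 : ‖l a‖ ≤ ‖a‖ := CB.norm_mk_le _ (norm_nonneg a) _
    have h5 : mnorm (CB.pair (CB.pair Φ (x.map (l a))) w) ≤ ‖a‖ * mnorm x * mnorm w * mnorm Φ :=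
      calc _ ≤ mnorm (CB.pair Φ (x.map (l a))) * mnorm w := h1
        _ ≤ (mnorm Φ * mnorm (x.map (l a))) * mnorm w :=
          mul_le_mul_of_nonneg_right h2 (mnorm_nonneg w)
        _ ≤ (mnorm Φ * (‖a‖ * mnorm x)) * mnorm w :=
          mul_le_mul_of_nonneg_right (mul_le_mul_of_nonneg_left
            (h3.trans (mul_le_mul_of_nonneg_right h4 (mnorm_nonneg x))) (mnorm_nonneg Φ))
            (mnorm_nonneg w)
        _ = _ := by ring
    refine le_trans (le_of_eq ?_) h5
    rw [← mnorm_reindex ((Equiv.prodAssoc (Fin m) ι κ).trans (Equiv.prodComm (Fin m) (ι × κ)))]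
    rfl
  have hex : ∀ a : A, ∃ L : CB (ProjTensor A W) (ProjTensor A W), ‖L‖ ≤ ‖a‖ ∧
      ∀ b w, L (ProjTensor.tmul b w) = ProjTensor.tmul (a * b) w := fun a =>
    ProjTensor.exists_lift ProjTensor.isDualNormed
      (ProjTensor.tmulₗ A W ∘ₗ LinearMap.mul ℂ A a) (norm_nonneg a) (hl a)
  choose L hL hLt using hex
  let act : A →ₗ[ℂ] ProjTensor A W →ₗ[ℂ] ProjTensor A W :=
    { toFun := fun a => (L a).toLin
      map_add' := fun a a' => by
        refine congrArg CB.toLin (ProjTensor.cb_ext (φ := L (a + a')) (ψ := L a + L a') fun b w => ?_)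
        rw [CB.coe_add, hLt, hLt, hLt, add_mul]
        exact LinearMap.congr_fun (map_add (ProjTensor.tmulₗ A W) (a * b) (a' * b)) w
      map_smul' := fun c a => by
        refine congrArg CB.toLin (ProjTensor.cb_ext (φ := L (c • a)) (ψ := c • L a) fun b w => ?_)
        rw [CB.coe_smul, hLt, hLt, smul_mul_assoc]
        exact LinearMap.congr_fun (map_smul (ProjTensor.tmulₗ A W) c (a * b)) w }
  -- a matrix `Φ` over `CB(A, W*)` tested at `[a_ij x_kl]` is the matrix `[Φ_pq(a_ij ·)]`
  -- tested at `x`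
  have hact : IsJointlyCB act 1 := by
    intro ι κ _ _ a x
    rw [one_mul]
    refine ProjTensor.mnorm_le _ (mul_nonneg (mnorm_nonneg a) (mnorm_nonneg x)) fun m Φ => ?_
    let Φ' : Matrix (Fin m × ι) (Fin m × ι) (CB A (OpDual W)) :=
      Matrix.of fun p q => CB.comp (Φ p.1 q.1) (l (a p.2 q.2))
    have hΦ' : mnorm Φ' ≤ mnorm Φ * mnorm a := by
      refine CB.mnorm_le _ (mul_nonneg (mnorm_nonneg Φ) (mnorm_nonneg a)) fun n b => ?_
      have h1 := CB.mnorm_pair_le Φ (Matrix.of fun p q : ι × Fin n => a p.1 q.1 * b p.2 q.2)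
      have h2 : mnorm (Matrix.of fun p q : ι × Fin n => a p.1 q.1 * b p.2 q.2) ≤
          1 * mnorm a * mnorm b := h ι (Fin n) a b
      rw [one_mul] at h2
      rw [mul_assoc]
      refine le_trans (le_of_eq ?_) (h1.trans (mul_le_mul_of_nonneg_left h2 (mnorm_nonneg Φ)))
      rw [← mnorm_reindex (Equiv.prodAssoc (Fin m) ι (Fin n))]
      rfl
    have hval : ∀ (a : A) (φ : CB A (OpDual W)) (y : ProjTensor A W),
        (L a y).functional φ = y.functional (CB.comp φ (l a)) := fun a φ y => by
      let J : CB (ProjTensor A W) (OpDual (CB A (OpDual W))) :=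
        CB.mk (tensorSubspace A W).subtype 1 fun n z => by rw [one_mul]; exact le_of_eq rfl
      have : CB.comp (CB.eval φ) (CB.comp J (L a)) = CB.comp (CB.eval (CB.comp φ (l a))) J :=
        ProjTensor.cb_ext fun b w => by
          change (L a (ProjTensor.tmul b w)).functional φ = _
          rw [hLt]
          rfl
      exact congrArg (fun ψ : CB (ProjTensor A W) ℂ => ψ y) this
    have h1 := ProjTensor.mnorm_pair_le x Φ'
    have h2 : mnorm x * mnorm Φ' ≤ mnorm a * mnorm x * mnorm Φ :=
      (mul_le_mul_of_nonneg_left hΦ' (mnorm_nonneg x)).trans (le_of_eq (by ring))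
    refine le_trans (le_of_eq ?_) (h1.trans h2)
    rw [← mnorm_reindex (((Equiv.prodComm ι κ).prodCongr (Equiv.refl (Fin m))).trans
      ((Equiv.prodAssoc κ ι (Fin m)).trans
        ((Equiv.refl κ).prodCongr (Equiv.prodComm ι (Fin m)))))]
    refine congrArg mnorm ?_
    ext p q
    exact hval _ _ _
  obtain ⟨π, -, hπ⟩ := ProjTensor.exists_lift ProjTensor.isDualNormed act zero_le_one hact
  refine ⟨⟨act, fun a b x => ?_, π, hπ⟩, hLt⟩
  have : L (a * b) = CB.comp (L a) (L b) := ProjTensor.cb_ext fun c w => by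
    rw [CB.comp_apply, hLt, hLt, hLt, mul_assoc]
  exact congrArg (fun φ : CB (ProjTensor A W) (ProjTensor A W) => φ x) this

end modules

/-! ### Functions in `A(G)` and `A_cb(G)` -/

section multipliers

variable {G : Type*} [Group G] {ι : Type} [Fintype ι]

namespace FourierAlgebra

/-- Evaluation at a point of `G` is completely contractive on `A(G)`. -/
lemma mnorm_apply_le (u : Matrix ι ι (FourierAlgebra G)) (s : G) :
    mnorm (u.map fun v => v s) ≤ mnorm u := by
  refine le_quotientNorm (LinearMap.ker (predualToFun G)) u fun φ hφ => ?_
  have e : u.map (fun v => v s) = (φ.map VNPredual.functional).map fun ψ => ψ (VN.of s) := by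
    ext1 i j
    have : (LinearMap.ker (predualToFun G)).mkQ (φ i j) = u i j := congrFun (congrFun hφ i) j
    rw [Matrix.map_apply, ← this]
    rfl
  rw [e]
  refine (CB.mnorm_map_apply_le (φ.map VNPredual.functional) (VN.of s)).trans ?_
  exact mul_le_of_le_one_right (mnorm_nonneg _) (norm_VN_of_le s)

variable [DecidableEq G]

/-- The function `δ_s` in `A(G)`. -/
def delta (s : G) : FourierAlgebra G := coeff (lp.single 2 1 1) (lp.single 2 s 1)

lemma delta_apply (s x : G) : delta s x = if x = s then 1 else 0 := by
  rw [delta, coeff_apply, lp.inner_single_left]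
  change inner ℂ (1 : ℂ) ((lp.single 2 (1 : G) (1 : ℂ) : EllTwo G) (x⁻¹ * s)) = _
  split_ifs with h
  · rw [h, inv_mul_cancel, lp.single_apply_self]
    simp
  · rw [lp.single_apply_ne, inner_zero_right]
    rwa [Ne, inv_mul_eq_one]

lemma norm_delta_le (s : G) : ‖delta s‖ ≤ 1 := by
  refine (Submodule.Quotient.norm_mk_le (S := LinearMap.ker (predualToFun G))
    (VNPredual.vector (lp.single 2 1 1) (lp.single 2 s 1))).trans
    ((VNPredual.norm_vector_le _ _).trans ?_)
  rw [lp.norm_single (by simp), lp.norm_single (by simp)]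
  simp

end FourierAlgebra

namespace Acb

lemma mul_apply (a b : Acb G) (x : G) : (a * b) x = a x * b x :=
  op_apply a (b.op _) x

protected lemma ext {a b : Acb G} (h : ∀ x, a x = b x) : a = b :=
  Subtype.ext (CB.ext fun v => FourierAlgebra.toFun_injective (funext fun x =>
    (op_apply a v x).trans ((congrArg (· * v x) (h x)).trans (op_apply b v x).symm)))

lemma add_apply (a b : Acb G) (x : G) : (a + b) x = a x + b x := by
  change FourierAlgebra.toFun (a.op _ + b.op _) x = _
  rw [map_add]
  rfl

lemma smul_apply (c : ℂ) (a : Acb G) (x : G) : (c • a) x = c * a x := by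
  change FourierAlgebra.toFun (c • a.op _) x = _
  rw [map_smul]
  rfl

lemma isDualNormed : IsDualNormed (Acb G) :=
  FourierAlgebra.isDualNormed.cb.submodule (multiplicationOperators G).topologicalClosure.toSubmodule

lemma isJointlyCB_mul : IsJointlyCB (LinearMap.mul ℂ (Acb G)) 1 := fun ι κ _ _ a b => by
  rw [one_mul]
  exact CB.mnorm_mul_le (a.map op) (b.map op)

variable [DecidableEq G]

/-- Evaluation at a point of `G` is completely contractive on `A_cb(G)`. -/
lemma mnorm_apply_le (a : Matrix ι ι (Acb G)) (s : G) : mnorm (a.map fun b => b s) ≤ mnorm a := by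
  have e : a.map (fun b => b s) =
      ((a.map op).map fun φ => φ (FourierAlgebra.delta s)).map fun v => v s := by
    ext i j
    simp only [Matrix.map_apply]
    rw [op_apply, FourierAlgebra.delta_apply, if_pos rfl, mul_one]
  rw [e]
  refine (FourierAlgebra.mnorm_apply_le _ s).trans
    ((CB.mnorm_map_apply_le (a.map op) (FourierAlgebra.delta s)).trans ?_)
  exact mul_le_of_le_one_right (mnorm_nonneg _) (FourierAlgebra.norm_delta_le s)

lemma norm_apply_le (a : Acb G) (s : G) : ‖a s‖ ≤ ‖a‖ := by
  rw [← mnorm_one_by_one, ← mnorm_one_by_one]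
  exact mnorm_apply_le (Matrix.of fun _ _ : Unit => a) s

/-- The rank one map `u ↦ u(s) δ_s` on `A(G)` is completely contractive. -/
lemma delta_bound (s : G) (u : Matrix ι ι (FourierAlgebra G)) :
    mnorm (u.map fun v => v s • FourierAlgebra.delta s) ≤ 1 * mnorm u := by
  have h := mnorm_kronecker_le (u.map fun v => v s)
    (Matrix.of fun _ _ : Unit => FourierAlgebra.delta s)
  rw [mnorm_one_by_one] at h
  rw [one_mul]
  refine le_trans (le_of_eq ?_) (h.trans ((mul_le_of_le_one_right (mnorm_nonneg _)
    (FourierAlgebra.norm_delta_le s)).trans (FourierAlgebra.mnorm_apply_le u s)))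
  rw [← mnorm_reindex (Equiv.prodPUnit.{0, 0} ι)]
  rfl

/-- The function `δ_s` in `A_cb(G)`: multiplication by `δ_s` is the rank one operator
`u ↦ u(s) δ_s`. -/
def delta (s : G) : Acb G :=
  ⟨CB.mk ((LinearMap.proj s ∘ₗ FourierAlgebra.toFun).smulRight (FourierAlgebra.delta s)) 1
      fun _ u => delta_bound s u,
    NonUnitalSubalgebra.le_topologicalClosure _ ⟨FourierAlgebra.delta s, fun v x => by
      change FourierAlgebra.toFun (v s • FourierAlgebra.delta s) x = _
      rw [map_smul, Pi.smul_apply, FourierAlgebra.delta_apply, smul_eq_mul]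
      split_ifs with h
      · rw [h, mul_comm]
      · rw [mul_zero, zero_mul]⟩⟩

lemma delta_apply (s x : G) : delta s x = if x = s then 1 else 0 := by
  have h : (delta s).op (FourierAlgebra.delta x) x =
      (FourierAlgebra.delta x s • FourierAlgebra.delta s : FourierAlgebra G) x := rfl
  rw [op_apply, FourierAlgebra.delta_apply, if_pos rfl, mul_one] at h
  rw [h, map_smul, Pi.smul_apply, FourierAlgebra.delta_apply, FourierAlgebra.delta_apply,
    smul_eq_mul]
  by_cases hx : x = s
  · simp [hx]
  · simp [hx]

lemma norm_delta_le (s : G) : ‖delta s‖ ≤ 1 :=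
  CB.norm_mk_le _ zero_le_one fun _ u => delta_bound s u

lemma mul_delta (a : Acb G) (s : G) : a * delta s = a s • delta s := Acb.ext fun x => by
  rw [mul_apply, smul_apply, delta_apply]
  split_ifs with h
  · rw [h]
  · rw [mul_zero, mul_zero]

end Acb

/-! ### The module `ℓ¹(G)` -/

variable [DecidableEq G]

/-- Pointwise multiplication of `ℓ¹(G)` by elements of `A_cb(G)`. -/
def pointwiseAction : Acb G →ₗ[ℂ] EllOne G →ₗ[ℂ] EllOne G :=
  LinearMap.mk₂ ℂ
    (fun a f => ⟨fun s => a s * f s, ((lp.memℓp f).const_smul (‖a‖ : ℂ)).mono' fun s => by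
      rw [Pi.smul_apply, norm_smul, norm_mul, Complex.norm_real, norm_norm]
      exact mul_le_mul_of_nonneg_right (a.norm_apply_le s) (norm_nonneg _)⟩)
    (fun a b f => lp.ext (E := fun _ : G => ℂ) (funext fun s => by
      change (a + b) s * f s = a s * f s + b s * f s
      rw [Acb.add_apply, add_mul]))
    (fun c a f => lp.ext (E := fun _ : G => ℂ) (funext fun s => by
      change (c • a) s * f s = c * (a s * f s)
      rw [Acb.smul_apply, mul_assoc]))
    (fun a f g => lp.ext (E := fun _ : G => ℂ) (funext fun s => mul_add (a s) (f s) (g s)))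
    (fun c a f => lp.ext (E := fun _ : G => ℂ) (funext fun s => mul_left_comm (a s) c (f s)))

lemma pointwiseAction_apply (a : Acb G) (f : EllOne G) (s : G) :
    pointwiseAction a f s = a s * f s := rfl

/-- Pointwise multiplication turns a test `T` in `ℓ^∞(G, M_n)` into the test `s ↦ [a_ij(s)] ⊗ T(s)`,
which is bounded since evaluations are completely contractive on `A_cb(G)`. -/
lemma isJointlyCB_pointwiseAction : IsJointlyCB (pointwiseAction (G := G)) 1 := by
  intro ι κ _ _ a f
  rw [one_mul]
  refine EllOne.mnorm_le _ fun n T hT => ?_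
  have h := EllOne.mnorm_tsum_le f
    (fun s => Matrix.of fun p q : ι × Fin n => a p.1 q.1 s * T s p.2 q.2) (mnorm_nonneg a) fun s =>
      (mnorm_kronecker_le (a.map fun b => b s) (T s)).trans
        ((mul_le_of_le_one_right (mnorm_nonneg _) (hT s)).trans (Acb.mnorm_apply_le a s))
  refine le_trans (le_of_eq ?_) h
  rw [← mnorm_reindex (((Equiv.prodComm ι κ).prodCongr (Equiv.refl (Fin n))).trans
    (Equiv.prodAssoc κ ι (Fin n)))]
  refine congrArg mnorm ?_
  ext p q
  refine tsum_congr fun s => ?_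
  rw [Matrix.of_apply, pointwiseAction_apply, mul_assoc, mul_left_comm]
  rfl

variable (G) in
lemma exists_leftModule_ellOne : ∃ M : CBLeftModule (Acb G) (EllOne G), M.act = pointwiseAction := by
  obtain ⟨π, -, hπ⟩ := ProjTensor.exists_lift EllOne.isDualNormed (pointwiseAction (G := G))
    zero_le_one isJointlyCB_pointwiseAction
  refine ⟨⟨pointwiseAction, fun a b f => lp.ext (E := fun _ : G => ℂ) (funext fun s => ?_), π, hπ⟩, rfl⟩
  rw [pointwiseAction_apply, pointwiseAction_apply, pointwiseAction_apply, Acb.mul_apply, mul_assoc]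

lemma pointwiseAction_single (a : Acb G) (s : G) :
    pointwiseAction a (lp.single 1 s 1) = a s • (lp.single 1 s 1 : EllOne G) := by
  refine lp.ext (E := fun _ : G => ℂ) (funext fun x => ?_)
  rw [pointwiseAction_apply, lp.coeFn_smul, Pi.smul_apply, smul_eq_mul]
  by_cases h : x = s
  · rw [h]
  · rw [lp.single_apply_ne _ _ _ h, mul_zero, mul_zero]

variable {M : CBLeftModule (Acb G) (EllOne G)} {E : Type*} [NormedAddCommGroup E] [NormedSpace ℂ E]
  [OperatorSpace E]

/-- A completely bounded map on `ℓ¹(G)` is a module map as soon as its value at each `δ_s` is an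
eigenvector of every `a` in `A_cb(G)`, with eigenvalue `a(s)`. -/
lemma isModuleMap_of_single (hM : M.act = pointwiseAction) (N : CBLeftModule (Acb G) E)
    (R : CB (EllOne G) E)
    (h : ∀ a s, N.act a (R (lp.single 1 s 1)) = a s • R (lp.single 1 s 1)) :
    IsModuleMap M N R := fun a f => by
  have : R.toCLM ∘L M.actCLM a = N.actCLM a ∘L R.toCLM := EllOne.clm_ext fun s => by
    change R (M.act a (lp.single 1 s 1)) = N.act a (R (lp.single 1 s 1))
    rw [h, hM, pointwiseAction_single, map_smul]
  exact DFunLike.congr_fun this f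

/-- `ℓ¹(G)` is operator projective. Bounded lifts `e_s` of `S(δ_s)` exist by the open mapping
theorem; the lift of `S` sends `δ_s` to `δ_s · e_s`. -/
lemma isOperatorProjective_ellOne.{w} (hM : M.act = pointwiseAction) :
    IsOperatorProjective.{_, _, w} M := by
  intro E F _ _ _ _ _ _ _ _ ME MF T hT _ hsurj S hS
  obtain ⟨C, hC, hlift⟩ := T.toCLM.exists_preimage_norm_le hsurj
  choose e he hle using fun s : G => hlift (S (lp.single 1 s 1))
  have hbd : ∀ s, ‖Acb.delta s‖ * ‖e s‖ ≤ C * ‖S‖ := fun s => by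
    refine (mul_le_of_le_one_left (norm_nonneg _) (Acb.norm_delta_le s)).trans ((hle s).trans ?_)
    refine mul_le_mul_of_nonneg_left ((S.norm_apply_le _).trans ?_) hC.le
    rw [lp.norm_single (by simp), norm_one, mul_one]
  obtain ⟨L, -, hL⟩ := EllOne.exists_cb_tmul Acb.delta e (by positivity) hbd
  have hR : ∀ s, CB.comp ME.π L (lp.single 1 s 1) = ME.act (Acb.delta s) (e s) := fun s => by
    rw [CB.comp_apply, hL, ME.π_tmul]
  refine ⟨CB.comp ME.π L, isModuleMap_of_single hM ME _ fun a s => ?_, fun f => ?_⟩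
  · rw [hR, ← ME.mul_act, Acb.mul_delta, map_smul]
    rfl
  · have : T.toCLM ∘L (CB.comp ME.π L).toCLM = S.toCLM := EllOne.clm_ext fun s => by
      change T (CB.comp ME.π L (lp.single 1 s 1)) = S (lp.single 1 s 1)
      have he' : T (e s) = S (lp.single 1 s 1) := he s
      rw [hR, hT, he', ← hS, hM, pointwiseAction_single, Acb.delta_apply, if_pos rfl, one_smul]
    exact DFunLike.congr_fun this f

end multipliers

end

theorem mainTheorem11 (G : Type u) [Group G] [DecidableEq G] :
    -- the category of completely bounded left `A_cb(G)`-modules makes sense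
    IsCompletelyContractive (Acb G) ∧
    -- `ℓ¹(G)` with pointwise multiplication is an operator projective object of it
    ∃ M : CBLeftModule (Acb G) (EllOne G),
      (∀ (a : Acb G) (f : EllOne G) (s : G), M.act a f s = a s * f s) ∧
      IsOperatorProjective.{u, u, v} M ∧
      -- `d s` is the function `δ_s` in `A_cb(G)`
      ∃ d : G → Acb G, (∀ s t : G, d s t = if t = s then 1 else 0) ∧
      -- the canonical module structure of `A_cb(G) ⊗̂ ℓ¹(G)`
      ∃ N : CBLeftModule (Acb G) (ProjTensor (Acb G) (EllOne G)),
        (∀ (a b : Acb G) (f : EllOne G),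
          N.act a (ProjTensor.tmul b f) = ProjTensor.tmul (a * b) f) ∧
        -- the splitting map
        ∃ ρ : CB (EllOne G) (ProjTensor (Acb G) (EllOne G)),
          (∀ s : G, ρ (lp.single 1 s 1) = ProjTensor.tmul (d s) (lp.single 1 s 1)) ∧
          ‖ρ‖ ≤ 1 ∧ IsModuleMap M N ρ ∧ ∀ f : EllOne G, M.π (ρ f) = f := by
  refine ⟨.of_isJointlyCB Acb.isDualNormed Acb.isJointlyCB_mul, ?_⟩
  obtain ⟨M, hM⟩ := exists_leftModule_ellOne G
  refine ⟨M, fun a f s => by rw [hM, pointwiseAction_apply], isOperatorProjective_ellOne hM,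
    Acb.delta, Acb.delta_apply, ?_⟩
  obtain ⟨N, hN⟩ := exists_leftModule_projTensor (Acb.isJointlyCB_mul (G := G)) (EllOne G)
  obtain ⟨ρ, hρ, hρs⟩ := EllOne.exists_cb_tmul Acb.delta
    (fun s : G => (lp.single 1 s 1 : EllOne G)) zero_le_one fun s => by
      rw [lp.norm_single (by simp), norm_one, mul_one]
      exact Acb.norm_delta_le s
  refine ⟨N, hN, ρ, hρs, hρ, isModuleMap_of_single hM N ρ fun a s => ?_, fun f => ?_⟩
  · rw [hρs, hN, Acb.mul_delta]
    exact LinearMap.congr_fun (map_smul (ProjTensor.tmulₗ (Acb G) (EllOne G)) (a s) _) _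
  · have : M.π.toCLM ∘L ρ.toCLM = ContinuousLinearMap.id ℂ (EllOne G) :=
      EllOne.clm_ext fun s => by
        change M.π (ρ (lp.single 1 s 1)) = _
        rw [hρs, M.π_tmul, hM, pointwiseAction_single, Acb.delta_apply, if_pos rfl, one_smul]
        rfl
    exact DFunLike.congr_fun this f
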